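/- Let $\Omega$ be a Polish space with its Borel $\sigma$-field, $C_b(\Omega)$ the space of bounded continuous real functions on $\Omega$, and $\mathrm{ca}(\Omega)$ the space of finite signed Borel measures on $\Omega$, in duality through $\nu(f)=\int_\Omega f\,d\nu$. Let $\mathcal P$ be a nonempty convex set of Borel probability measures on $\Omega$ that is compact for the weak topology induced by $C_b(\Omega)$. For Borel $\xi:\Omega\to\mathbb R$ put $\|\xi\|_{1,\mathcal P}=\sup_{P\in\mathcal P}E_P[|\xi|]$; write $\xi\in\mathbb L_1(\mathcal P)$ if $\|\xi\|_{1,\mathcal P}<\infty$, and $\xi\in\mathbb L_{1,b}(\mathcal P)$ if moreover $\lim_{n}\|\xi 1_{\{|\xi|>n\}}\|_{1,\mathcal P}=0$. Let $\varphi:\Omega\times\mathbb R\to\mathbb R$ be such that (i) $x\mapsto\varphi(\omega,x)$ is a (finite) convex function for every $\omega\in\Omega$; (ii) $\omega\mapsto\varphi(\omega,x)$ is upper semicontinuous for every $x\in\mathbb R$; (iii) $\varphi(\cdot,x)^+\in\mathbb L_{1,b}(\mathcal P)$ for every $x\in\mathbb R$; (iv) $\varphi(\cdot,0)^-\in\mathbb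 L_1(\mathcal P)$. Put $\varphi^*(\omega,y)=\sup_{x\in\mathbb R}(xy-\varphi(\omega,x))$ and $$I_{\varphi,\mathcal P}(f)=\sup_{P\in\mathcal P}E_P[\varphi(\cdot,f(\cdot))],\qquad f\in C_b(\Omega),$$ $$J_{\varphi^*}(\nu|P)=\begin{cases}E_P[\varphi^*(\cdot,d\nu/dP)]&\text{if }\nu\ll P,\\+\infty&\text{otherwise,}\end{cases}\qquad J_{\varphi^*,\mathcal P}(\nu)=\inf_{P\in\mathcal P}J_{\varphi^*}(\nu|P),\qquad \nu\in\mathrm{ca}(\Omega).$$ Then $\varphi(\cdot,f(\cdot))$ is $P$-integrable for all $f\in C_b(\Omega)$ and $P\in\mathcal P$, and $I_{\varphi,\mathcal P}$ is finite on $C_b(\Omega)$. The function $I_{\varphi,\mathcal P}:C_b(\Omega)\to\mathbb R$ is continuous for the Mackey topology $\tau(C_b(\Omega),\mathrm{ca}(\Omega))$, i.e. the topology of uniform convergence on the absolutely convex $\sigma(\mathrm{ca}(\Omega),C_b(\Omega))$-compact subsets of $\mathrm{ca}(\Omega)$, and its conjugate is $$I_{\varphi,\mathcal P}^*(\nu):=\sup_{f\in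 C_b(\Omega)}\bigl(\nu(f)-I_{\varphi,\mathcal P}(f)\bigr)=J_{\varphi^*,\mathcal P}(\nu),\qquad \nu\in\mathrm{ca}(\Omega).$$ In particular, $$I_{\varphi,\mathcal P}(f)=\max_{\nu\in\mathrm{ca}(\Omega)}\bigl(\nu(f)-J_{\varphi^*,\mathcal P}(\nu)\bigr),\qquad f\in C_b(\Omega),$$ the maximum being attained. -/

import Mathlib

open MeasureTheory Set Filter Topology
open scoped ENNReal BoundedContinuousFunction

noncomputable section

/-- The Mackey topology `τ(E, F)` of a bilinear pairing `B` of real vector spaces `E` and `F`: the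
topology on `E` of uniform convergence on the absolutely convex `σ(F, E)`-compact subsets of `F`.
Here `WeakBilin B.flip` is the space `F` with the weak topology `σ(F, E)`. -/
@[reducible] def mackeyTopology {E F : Type*} [AddCommGroup E] [Module ℝ E] [AddCommGroup F] [Module ℝ F]
    (B : E →ₗ[ℝ] F →ₗ[ℝ] ℝ) : TopologicalSpace E :=
  TopologicalSpace.induced
    (fun x : E => UniformOnFun.ofFun
      {K : Set F | AbsConvex ℝ K ∧ IsCompact (X := WeakBilin B.flip) K} (fun y : F => B x y))
    inferInstance

section Pairing

variable {Ω : Type*} [TopologicalSpace Ω] [MeasurableSpace Ω] [BorelSpace Ω]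

/-- Bounded continuous functions are integrable against every finite signed Borel measure. -/
theorem boundedContinuous_integrable_signed (f : Ω →ᵇ ℝ) (ν : SignedMeasure Ω) :
    ν.Integrable f := by
  have : IsFiniteMeasure (VectorMeasure.variation ν) := by
    rw [← SignedMeasure.totalVariation_eq_variation]
    infer_instance
  exact f.integrable (VectorMeasure.variation ν)

variable (Ω) in
/-- The canonical pairing `⟨f, ν⟩ = ν(f) = ∫ f dν` of `C_b(Ω)` with the space `ca(Ω)` of finite
signed Borel measures. -/
def caPairing : (Ω →ᵇ ℝ) →ₗ[ℝ] SignedMeasure Ω →ₗ[ℝ] ℝ :=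
  LinearMap.mk₂ ℝ (fun f ν => ∫ᵛ ω, f ω ∂<•ν)
    (fun f g ν => VectorMeasure.integral_fun_add
      (boundedContinuous_integrable_signed f ν) (boundedContinuous_integrable_signed g ν))
    (fun c f ν => VectorMeasure.integral_fun_smul ν _ c f)
    (fun f μ ν => VectorMeasure.integral_add_vectorMeasure
      (boundedContinuous_integrable_signed f μ) (boundedContinuous_integrable_signed f ν))
    (fun c f _ => VectorMeasure.integral_smul_vectorMeasure f c)

end Pairing

section Functionals

variable {Ω : Type*} [MeasurableSpace Ω]

/-- The robust `L¹` (semi)norm `‖ξ‖_{1,𝒬} = sup_{P ∈ 𝒬} E_P[|ξ|]`, with values in `[0, ∞]`. -/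
def robustL1Norm (𝒬 : Set (ProbabilityMeasure Ω)) (ξ : Ω → ℝ) : ℝ≥0∞ :=
  ⨆ P ∈ 𝒬, ∫⁻ ω, ENNReal.ofReal |ξ ω| ∂(P : Measure Ω)

/-- `ξ` is a (representative of an) element of `𝕃₁(𝒬)`. -/
def MemRobustL1 (𝒬 : Set (ProbabilityMeasure Ω)) (ξ : Ω → ℝ) : Prop :=
  Measurable ξ ∧ robustL1Norm 𝒬 ξ < ∞

/-- `ξ` is a (representative of an) element of `𝕃_{1,b}(𝒬)`: it belongs to `𝕃₁(𝒬)` and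
`‖ξ 1_{|ξ| > n}‖_{1,𝒬} → 0`, i.e. `ξ` is uniformly integrable over `𝒬`. -/
def MemRobustL1b (𝒬 : Set (ProbabilityMeasure Ω)) (ξ : Ω → ℝ) : Prop :=
  MemRobustL1 𝒬 ξ ∧
    Tendsto (fun n : ℕ => robustL1Norm 𝒬 ({ω | (n : ℝ) < |ξ ω|}.indicator ξ)) atTop (𝓝 0)

/-- The expectation `E_P[g] = E_P[g⁺] - E_P[g⁻]` of an extended real valued function. -/
def erealExpectation (P : ProbabilityMeasure Ω) (g : Ω → EReal) : EReal :=
  ((∫⁻ ω, (g ω).toENNReal ∂(P : Measure Ω) : ℝ≥0∞) : EReal) -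
    ((∫⁻ ω, (-g ω).toENNReal ∂(P : Measure Ω) : ℝ≥0∞) : EReal)

/-- The partial conjugate `φ*(ω, y) = sup_x (x y - φ(ω, x))`. -/
def integrandConj (φ : Ω → ℝ → ℝ) (ω : Ω) (y : ℝ) : EReal :=
  ⨆ x : ℝ, ((x * y - φ ω x : ℝ) : EReal)

/-- The robust integral functional `I_{φ,𝒬}(f) = sup_{P ∈ 𝒬} E_P[φ(·, f)]`. -/
def robustIntegral [TopologicalSpace Ω] (φ : Ω → ℝ → ℝ) (𝒬 : Set (ProbabilityMeasure Ω))
    (f : Ω →ᵇ ℝ) : EReal :=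
  ⨆ P ∈ 𝒬, erealExpectation P (fun ω => (φ ω (f ω) : EReal))

open scoped Classical in
/-- The divergence `J_{φ*}(ν | P)`: it is `E_P[φ*(·, dν/dP)]` if `ν ≪ P`, and `+∞` otherwise. -/
def divergence (φ : Ω → ℝ → ℝ) (ν : SignedMeasure Ω) (P : ProbabilityMeasure Ω) : EReal :=
  if ν ≪ᵥ (P : Measure Ω).toENNRealVectorMeasure then
    erealExpectation P (fun ω => integrandConj φ ω (ν.rnDeriv (P : Measure Ω) ω))
  else ⊤

/-- The robust divergence `J_{φ*,𝒬}(ν) = inf_{P ∈ 𝒬} J_{φ*}(ν | P)`. -/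
def robustDivergence (φ : Ω → ℝ → ℝ) (𝒬 : Set (ProbabilityMeasure Ω)) (ν : SignedMeasure Ω) :
    EReal :=
  ⨅ P ∈ 𝒬, divergence φ ν P

end Functionals

end

/-! For fixed `P`, the conjugate of `f ↦ E_P[φ(·, f)]` is `J_{φ*}(· | P)`. One inequality is
Young's. For the other, bounded measurable near-maximizers of `x y - φ(ω, x)` are approximated
almost everywhere by uniformly bounded continuous functions (`exists_bcf_lt_of_lt_divergence`); when
`ν` is not absolutely continuous, functions concentrated near a `P`-null set charged by `ν` make the
supremum infinite.

The conjugate of the supremum over `P` then requires exchanging `sup_f` and `inf_P`. The minimax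
theorem applies because `P ↦ E_P[φ(·, f)]` is upper semicontinuous on the compact set `𝒬`
(`upperSemicontinuousOn_integral`): `φ(·, f)` is upper semicontinuous and uniformly integrable from
above. The same property gives a maximizing `P` for each `f`, and a measurable subgradient `η` of
`φ(ω, ·)` at `f ω` gives the measure `η P` attaining the dual maximum.

For Mackey continuity, a function with subgradients everywhere is controlled near `0` on the polar
of a sublevel set of its conjugate (`abs_sub_le_of_subgradient`). It remains to enclose sublevel
sets of the robust divergence in absolutely convex weakly compact sets. If `J_{φ*}(ν | P) ≤ c`,
Young's inequality at `±k` bounds `k ∫_A |dν/dP| dP` by a constant plus the integral over `A` of the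
positive part of `max (φ(·, -k)) (φ(·, k))`. Tightness of `𝒬` and uniform integrability make the
tails of `ν` uniformly small, and Prokhorov's theorem concludes. -/

/-! ### Minimax -/

/-- A one-sided minimax theorem of Ky Fan type: `S` is compact, `F` is lower semicontinuous and
convexlike in the first variable, and concave in the second one. -/
theorem IsCompact.exists_forall_le_of_convexlike {X E : Type*} [TopologicalSpace X]
    [AddCommGroup E] [Module ℝ E] {S : Set X} (hS : IsCompact S) (F : X → E → ℝ)
    (hlsc : ∀ e, LowerSemicontinuousOn (fun x => F x e) S)
    (hconvex : ∀ x ∈ S, ∀ y ∈ S, ∀ a b : ℝ, 0 ≤ a → 0 ≤ b → a + b = 1 →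
      ∃ z ∈ S, ∀ e, F z e ≤ a * F x e + b * F y e)
    (hconcave : ∀ x ∈ S, ConcaveOn ℝ univ (F x)) {c : ℝ} (h : ∀ x ∈ S, ∃ e, c < F x e) :
    ∃ e, ∀ x ∈ S, c ≤ F x e := by
  classical
  have hnhds : ∀ x ∈ S, ∃ e, {y | c < F y e} ∈ 𝓝[S] x := fun x hx => by
    obtain ⟨e, he⟩ := h x hx
    exact ⟨e, hlsc e x hx c he⟩
  choose! e he using hnhds
  rcases S.eq_empty_or_nonempty with rfl | ⟨x₀, hx₀⟩
  · exact ⟨0, by simp⟩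
  obtain ⟨t, -, ht⟩ := hS.elim_nhdsWithin_subcover (fun x => {y | c < F y (e x)}) he
  -- Compactness leaves finitely many test points `e i`. The upward closure of the values `F x (e i)
  -- - c` is convex by convexlikeness and misses the open negative orthant by the covering property;
  -- a separating functional supplies the weights.
  set A : Set (t → ℝ) := {v | ∃ x ∈ S, ∀ i : t, F x (e i.1) - c ≤ v i} with hA
  have hAconv : Convex ℝ A := by
    rintro v ⟨x, hx, hv⟩ w ⟨y, hy, hw⟩ a b ha hb hab
    obtain ⟨z, hz, hzle⟩ := hconvex x hx y hy a b ha hb hab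
    refine ⟨z, hz, fun i => ?_⟩
    have h1 := hzle (e i.1)
    have h2 := mul_le_mul_of_nonneg_left (hv i) ha
    have h3 := mul_le_mul_of_nonneg_left (hw i) hb
    have h4 : c = a * c + b * c := by rw [← add_mul, hab, one_mul]
    simp only [Pi.add_apply, Pi.smul_apply, smul_eq_mul]
    linarith
  set B : Set (t → ℝ) := {v | ∀ i, v i < 0} with hB
  have hBconv : Convex ℝ B := by
    have : B = univ.pi fun _ => Iio 0 := by ext; simp [hB]
    rw [this]
    exact convex_pi fun _ _ => convex_Iio 0
  have hBopen : IsOpen B := by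
    have : B = univ.pi fun _ => Iio 0 := by ext; simp [hB]
    rw [this]
    exact isOpen_set_pi finite_univ fun _ _ => isOpen_Iio
  have hdisj : Disjoint B A := by
    rw [Set.disjoint_left]
    rintro v hv ⟨x, hx, hxv⟩
    obtain ⟨i, hi, hxi⟩ := mem_iUnion₂.1 (ht hx)
    have h1 := hxv ⟨i, hi⟩
    have h2 := hv ⟨i, hi⟩
    have h3 : c < F x (e i) := hxi
    linarith
  obtain ⟨l, u, hlB, hlA⟩ := geometric_hahn_banach_open hBconv hBopen hAconv hdisj
  set w : t → ℝ := fun i => l (Pi.single i 1) with hw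
  have hl : ∀ v, l v = ∑ i, w i * v i := fun v => by
    conv_lhs => rw [← Finset.univ_sum_single v]
    rw [map_sum]
    refine Finset.sum_congr rfl fun i _ => ?_
    rw [hw, mul_comm, ← smul_eq_mul, ← map_smul, ← Pi.single_smul]
    simp
  have hu : 0 ≤ u := by
    by_contra! hneg
    have hs : ∀ s : ℝ, 0 < s → -s * ∑ i, w i < u := fun s hs => by
      have := hlB (fun _ => -s) (fun _ => by simpa using hs)
      rw [hl] at this
      rwa [← Finset.sum_mul, mul_comm] at this
    have htend : Tendsto (fun s : ℝ => -s * ∑ i, w i) (𝓝[>] 0) (𝓝 0) := by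
      have : Continuous fun s : ℝ => -s * ∑ i, w i := by fun_prop
      simpa using (this.tendsto 0).mono_left nhdsWithin_le_nhds
    have := le_of_tendsto htend (eventually_mem_nhdsWithin.mono fun s hs' => (hs s hs').le)
    linarith
  -- The orthant is unbounded in each direction `-e_i`, so a negative weight would make the
  -- functional unbounded above on it.
  have hwnn : ∀ i, 0 ≤ w i := by
    intro i
    by_contra! hneg
    have hs : ∀ s : ℝ, 0 < s → -(∑ j, w j) - s * w i < u := fun s hs => by
      have := hlB (fun j => -1 - (if j = i then s else 0)) (fun j => by
        dsimp only; split_ifs <;> linarith)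
      rw [hl] at this
      rw [mul_comm s]
      simpa [mul_sub, Finset.sum_sub_distrib] using this
    have h1 := hs ((|u + ∑ j, w j| + 1) / -w i) (by
      apply div_pos (by positivity) (by linarith))
    have h2 : (|u + ∑ j, w j| + 1) / -w i * w i = -(|u + ∑ j, w j| + 1) := by
      have := hneg.ne
      field_simp
    have := le_abs_self (u + ∑ j, w j)
    linarith
  have hwpos : 0 < ∑ i, w i := by
    have h1 := hlB (fun _ => -1) (fun _ => by norm_num)
    have h2 := hlA _ ⟨x₀, hx₀, fun i => le_rfl⟩
    refine (Finset.sum_nonneg fun i _ => hwnn i).lt_of_ne fun h0 => ?_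
    have hz : ∀ i, w i = 0 := fun i =>
      (Finset.sum_eq_zero_iff_of_nonneg fun i _ => hwnn i).1 h0.symm i (Finset.mem_univ i)
    simp only [hl, hz, zero_mul, Finset.sum_const_zero] at h1 h2
    linarith
  -- The weighted barycentre works: separation bounds the weighted average of the `F x (e i)` below
  -- by `c`, and concavity passes this to the barycentre.
  refine ⟨(∑ i, w i)⁻¹ • ∑ i, w i • e i.1, fun x hx => ?_⟩
  have h1 := hlA _ ⟨x, hx, fun i => le_rfl⟩
  rw [hl] at h1
  have h2 := (hconcave x hx).le_map_centerMass (t := Finset.univ) (w := w) (p := fun i : t => e i.1)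
    (fun i _ => hwnn i) hwpos (fun i _ => mem_univ _)
  refine le_trans ?_ h2
  rw [Finset.centerMass, smul_eq_mul, inv_mul_eq_div, le_div_iff₀ hwpos]
  simp only [Function.comp, smul_eq_mul]
  simp only [mul_sub, Finset.sum_sub_distrib, ← Finset.sum_mul] at h1
  linarith

/-! ### Weak limits and signed measures with densities -/

/-- Weak lower semicontinuity of the integral of a nonnegative lower semicontinuous function. -/
theorem LowerSemicontinuous.lintegral_ofReal_le_liminf {Ω : Type*} [MeasurableSpace Ω]
    [TopologicalSpace Ω] [OpensMeasurableSpace Ω] [HasOuterApproxClosed Ω]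
    {μ : ProbabilityMeasure Ω} {μs : ℕ → ProbabilityMeasure Ω} (hμs : Tendsto μs atTop (𝓝 μ))
    {f : Ω → ℝ} (hf : LowerSemicontinuous f) (hf0 : 0 ≤ f) :
    ∫⁻ x, ENNReal.ofReal (f x) ∂(μ : Measure Ω) ≤
      atTop.liminf fun i => ∫⁻ x, ENNReal.ofReal (f x) ∂(μs i : Measure Ω) := by
  -- The layer-cake formula reduces the claim to open superlevel sets (portmanteau) and Fatou's
  -- lemma in the level `t`.
  simp_rw [lintegral_eq_lintegral_meas_lt _ (Eventually.of_forall hf0) hf.measurable.aemeasurable]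
  calc ∫⁻ t in Ioi (0 : ℝ), (μ : Measure Ω) {a | t < f a}
      ≤ ∫⁻ t in Ioi (0 : ℝ), atTop.liminf fun i => (μs i : Measure Ω) {a | t < f a} :=
        lintegral_mono fun t =>
          ProbabilityMeasure.le_liminf_measure_open_of_tendsto hμs (hf.isOpen_preimage t)
    _ ≤ atTop.liminf fun i => ∫⁻ t in Ioi (0 : ℝ), (μs i : Measure Ω) {a | t < f a} :=
        lintegral_liminf_le fun n => Antitone.measurable fun s t hst =>
          measure_mono fun ω hω => lt_of_le_of_lt hst hω

theorem integral_withDensity_pos_sub_neg {Ω : Type*} [MeasurableSpace Ω] (μ : Measure Ω)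
    {η : Ω → ℝ} (hη : Integrable η μ) (hηm : Measurable η) {u : Ω → ℝ} (hu : Measurable u)
    {M : ℝ} (hM : ∀ ω, |u ω| ≤ M) :
    ∫ ω, u ω ∂(μ.withDensity fun ω => ENNReal.ofReal (η ω)) -
      ∫ ω, u ω ∂(μ.withDensity fun ω => ENNReal.ofReal (-η ω)) = ∫ ω, u ω * η ω ∂μ := by
  have hpos : ∀ ζ : Ω → ℝ, Measurable ζ → Integrable (fun ω => u ω * ζ ω) μ →
      Integrable (fun ω => u ω * max (ζ ω) 0) μ ∧
        ∫ ω, u ω ∂(μ.withDensity fun ω => ENNReal.ofReal (ζ ω)) = ∫ ω, u ω * max (ζ ω) 0 ∂μ := by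
    intro ζ hζ hint
    constructor
    · refine hint.mono (by fun_prop) (Eventually.of_forall fun ω => ?_)
      rw [norm_mul, norm_mul]
      gcongr
      rw [Real.norm_eq_abs, Real.norm_eq_abs, abs_of_nonneg (le_max_right _ _)]
      exact max_le (le_abs_self _) (abs_nonneg _)
    · rw [integral_withDensity_eq_integral_toReal_smul (by fun_prop)
        (Eventually.of_forall fun _ => ENNReal.ofReal_lt_top)]
      refine integral_congr_ae (Eventually.of_forall fun ω => ?_)
      simp [ENNReal.toReal_ofReal', mul_comm]
  have hint : Integrable (fun ω => u ω * η ω) μ :=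
    hη.bdd_mul hu.aestronglyMeasurable (Eventually.of_forall hM)
  obtain ⟨i1, e1⟩ := hpos η hηm hint
  obtain ⟨i2, e2⟩ := hpos (fun ω => -η ω) hηm.neg (by simpa using hint.neg)
  rw [e1, e2, ← integral_sub i1 i2]
  refine integral_congr_ae (Eventually.of_forall fun ω => ?_)
  dsimp only
  rcases le_total (η ω) 0 with h | h
  · rw [max_eq_right h, max_eq_left (by linarith)]; ring
  · rw [max_eq_left h, max_eq_right (by linarith)]; ring

section Pairing

variable {Ω : Type*} [TopologicalSpace Ω] [MeasurableSpace Ω] [BorelSpace Ω]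

theorem caPairing_toSignedMeasure_sub (f : Ω →ᵇ ℝ) (μ₁ μ₂ : Measure Ω) [IsFiniteMeasure μ₁]
    [IsFiniteMeasure μ₂] :
    caPairing Ω f (μ₁.toSignedMeasure - μ₂.toSignedMeasure) = ∫ ω, f ω ∂μ₁ - ∫ ω, f ω ∂μ₂ := by
  rw [map_sub]
  simp [caPairing]

theorem caPairing_withDensityᵥ (f : Ω →ᵇ ℝ) (μ : Measure Ω) [IsFiniteMeasure μ] {η : Ω → ℝ}
    (hη : Integrable η μ) (hηm : Measurable η) :
    caPairing Ω f (μ.withDensityᵥ η) = ∫ ω, f ω * η ω ∂μ := by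
  have h1 := isFiniteMeasure_withDensity_ofReal hη.2
  have h2 := isFiniteMeasure_withDensity_ofReal hη.neg.2
  rw [withDensityᵥ_eq_withDensity_pos_part_sub_withDensity_neg_part hη]
  exact (caPairing_toSignedMeasure_sub f _ _).trans
    (integral_withDensity_pos_sub_neg μ hη hηm f.continuous.measurable f.norm_coe_le_norm)

end Pairing

/-! ### Convex integrands: bounds, measurability, integrability -/

/-- A finite convex integrand that is upper semicontinuous in `ω`, whose positive parts are
uniformly integrable over `𝒬` (in terms of the excess over high levels) and whose negative part
at `0` is bounded in `L¹` over `𝒬`. -/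
structure RobustIntegrand {Ω : Type*} [TopologicalSpace Ω] [MeasurableSpace Ω]
    (𝒬 : Set (ProbabilityMeasure Ω)) (φ : Ω → ℝ → ℝ) : Prop where
  convexOn : ∀ ω, ConvexOn ℝ univ (φ ω)
  usc : ∀ x, UpperSemicontinuous fun ω => φ ω x
  exists_excess_le : ∀ x, ∀ ε : ℝ≥0∞, ε ≠ 0 → ∃ N : ℝ, 0 ≤ N ∧
    ∀ P ∈ 𝒬, ∫⁻ ω, ENNReal.ofReal (φ ω x - N) ∂(P : Measure Ω) ≤ ε
  exists_neg_le : ∃ C : ℝ≥0∞, C ≠ ∞ ∧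
    ∀ P ∈ 𝒬, ∫⁻ ω, ENNReal.ofReal (-φ ω 0) ∂(P : Measure Ω) ≤ C

/-- An upper bound for a convex integrand on `[-M, M]`. -/
def integrandUpper {Ω : Type*} (φ : Ω → ℝ → ℝ) (M : ℝ) (ω : Ω) : ℝ := max (φ ω (-M)) (φ ω M)

/-- A bound for the absolute value of a convex integrand on `[-M, M]`. -/
def integrandEnvelope {Ω : Type*} (φ : Ω → ℝ → ℝ) (M : ℝ) (ω : Ω) : ℝ :=
  max (integrandUpper φ M ω) 0 + 2 * max (-φ ω 0) 0

section

variable {Ω : Type*} [MeasurableSpace Ω]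

theorem lintegral_le_robustL1Norm {𝒬 : Set (ProbabilityMeasure Ω)} {ξ : Ω → ℝ}
    {P : ProbabilityMeasure Ω} (hP : P ∈ 𝒬) :
    ∫⁻ ω, ENNReal.ofReal |ξ ω| ∂(P : Measure Ω) ≤ robustL1Norm 𝒬 ξ :=
  le_iSup₂ (f := fun (P : ProbabilityMeasure Ω) (_ : P ∈ 𝒬) =>
    ∫⁻ ω, ENNReal.ofReal |ξ ω| ∂(P : Measure Ω)) P hP

/-- The excess `(ξ - n)⁺` is dominated by `|ξ| 1_{|ξ| > n}`. Being monotone in `ξ`, the excess form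
passes to smaller functions with no lower bound, which makes the hypotheses stable under
translation. -/
theorem MemRobustL1b.exists_excess_le {𝒬 : Set (ProbabilityMeasure Ω)} {ξ : Ω → ℝ}
    (h : MemRobustL1b 𝒬 ξ) {ε : ℝ≥0∞} (hε : ε ≠ 0) :
    ∃ N : ℝ, 0 ≤ N ∧ ∀ P ∈ 𝒬, ∫⁻ ω, ENNReal.ofReal (ξ ω - N) ∂(P : Measure Ω) ≤ ε := by
  obtain ⟨n, hn⟩ := (h.2.eventually (ge_mem_nhds (pos_iff_ne_zero.2 hε))).exists
  refine ⟨n, by positivity, fun P hP => le_trans (lintegral_mono fun ω => ?_)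
    ((lintegral_le_robustL1Norm hP).trans hn)⟩
  have hn0 : (0 : ℝ) ≤ n := by positivity
  by_cases hω : (n : ℝ) < |ξ ω|
  · rw [indicator_of_mem (by exact hω)]
    exact ENNReal.ofReal_le_ofReal (by linarith [le_abs_self (ξ ω)])
  · rw [ENNReal.ofReal_of_nonpos (by linarith [le_abs_self (ξ ω)])]
    exact zero_le

end

namespace RobustIntegrand

variable {Ω : Type*} [TopologicalSpace Ω] [MeasurableSpace Ω] {𝒬 : Set (ProbabilityMeasure Ω)}
  {φ : Ω → ℝ → ℝ}

theorem of_memRobustL1b (hφ_convex : ∀ ω, ConvexOn ℝ univ (φ ω))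
    (hφ_usc : ∀ x, UpperSemicontinuous (fun ω => φ ω x))
    (hφ_pos : ∀ x, MemRobustL1b 𝒬 (fun ω => max (φ ω x) 0))
    (hφ_neg : MemRobustL1 𝒬 (fun ω => max (-φ ω 0) 0)) : RobustIntegrand 𝒬 φ where
  convexOn := hφ_convex
  usc := hφ_usc
  exists_excess_le x ε hε := by
    obtain ⟨N, hN, h⟩ := (hφ_pos x).exists_excess_le hε
    refine ⟨N, hN, fun P hP => (lintegral_mono fun ω => ?_).trans (h P hP)⟩
    exact ENNReal.ofReal_le_ofReal (by linarith [le_max_left (φ ω x) 0])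
  exists_neg_le := by
    refine ⟨_, hφ_neg.2.ne, fun P hP =>
      (lintegral_mono fun ω => ?_).trans (lintegral_le_robustL1Norm hP)⟩
    exact ENNReal.ofReal_le_ofReal ((le_max_left _ _).trans (le_abs_self _))

variable (h : RobustIntegrand 𝒬 φ)
include h

theorem continuous (ω : Ω) : Continuous (φ ω) :=
  continuousOn_univ.1 ((h.convexOn ω).continuousOn isOpen_univ)

theorem le_integrandUpper {M x : ℝ} (hx : |x| ≤ M) (ω : Ω) : φ ω x ≤ integrandUpper φ M ω :=
  (h.convexOn ω).le_max_of_mem_Icc (mem_univ _) (mem_univ _) (abs_le.1 hx)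

/-- Midpoint convexity at `0`. It turns upper bounds at `-x` into lower bounds at `x`, so only the
negative part at `0` has to be controlled. -/
theorem two_mul_sub_le (x : ℝ) (ω : Ω) : 2 * φ ω 0 - φ ω (-x) ≤ φ ω x := by
  have := (h.convexOn ω).2 (mem_univ x) (mem_univ (-x)) (by norm_num : (0 : ℝ) ≤ 1 / 2)
    (by norm_num : (0 : ℝ) ≤ 1 / 2) (by norm_num)
  simp only [smul_eq_mul] at this
  rw [show 1 / 2 * x + 1 / 2 * -x = 0 by ring] at this
  linarith

theorem abs_le_integrandEnvelope {M x : ℝ} (hx : |x| ≤ M) (ω : Ω) :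
    |φ ω x| ≤ integrandEnvelope φ M ω := by
  have h1 := h.le_integrandUpper hx ω
  have h2 := h.le_integrandUpper (M := M) (x := -x) (by rwa [abs_neg]) ω
  have h3 := h.two_mul_sub_le x ω
  have h4 := le_max_left (integrandUpper φ M ω) 0
  have h5 := le_max_left (-φ ω 0) 0
  have h6 := le_max_right (-φ ω 0) 0
  rw [abs_le, integrandEnvelope]
  constructor <;> linarith

/-- Semicontinuity is assumed only at constant `x`; convexity bounds `φ ω` on a small interval
around `f ω₀` by its values at the two endpoints, which are constants. -/
theorem usc_comp {f : Ω → ℝ} (hf : Continuous f) : UpperSemicontinuous fun ω => φ ω (f ω) := by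
  intro ω₀ c hc
  obtain ⟨δ, hδ, hball⟩ := Metric.isOpen_iff.1 ((isOpen_Iio (a := c)).preimage (h.continuous ω₀))
    (f ω₀) hc
  have h1 : φ ω₀ (f ω₀ - δ / 2) < c := hball (by
    rw [Metric.mem_ball, Real.dist_eq, sub_sub_cancel_left, abs_neg, abs_of_pos] <;> linarith)
  have h2 : φ ω₀ (f ω₀ + δ / 2) < c := hball (by
    rw [Metric.mem_ball, Real.dist_eq, add_sub_cancel_left, abs_of_pos] <;> linarith)
  filter_upwards [h.usc _ ω₀ c h1, h.usc _ ω₀ c h2,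
    hf.continuousAt.eventually (Icc_mem_nhds (a := f ω₀ - δ / 2) (b := f ω₀ + δ / 2)
      (by linarith) (by linarith))] with ω hω1 hω2 hω3
  exact ((h.convexOn ω).le_max_of_mem_Icc (mem_univ _) (mem_univ _) hω3).trans_lt
    (max_lt hω1 hω2)

variable [BorelSpace Ω]

theorem measurable_left (x : ℝ) : Measurable fun ω => φ ω x := (h.usc x).measurable

theorem measurable_comp {u : Ω → ℝ} (hu : Measurable u) : Measurable fun ω => φ ω (u ω) := by
  have := (stronglyMeasurable_uncurry_of_continuous_of_stronglyMeasurable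
    (u := fun x ω => φ ω x) h.continuous fun x => (h.measurable_left x).stronglyMeasurable).measurable
  exact this.comp (hu.prodMk measurable_id)

theorem measurable_integrandUpper (M : ℝ) : Measurable (integrandUpper φ M) :=
  (h.measurable_left _).max (h.measurable_left _)

theorem measurable_integrandEnvelope (M : ℝ) : Measurable (integrandEnvelope φ M) :=
  ((h.measurable_integrandUpper M).max measurable_const).add
    (((h.measurable_left 0).neg.max measurable_const).const_mul 2)

theorem exists_excess_upper_le (M : ℝ) {ε : ℝ≥0∞} (hε : ε ≠ 0) : ∃ N : ℝ, 0 ≤ N ∧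
    ∀ P ∈ 𝒬, ∫⁻ ω, ENNReal.ofReal (integrandUpper φ M ω - N) ∂(P : Measure Ω) ≤ ε := by
  obtain ⟨N₁, hN₁, h₁⟩ := h.exists_excess_le (-M) (ε / 2) (by simpa using hε)
  obtain ⟨N₂, hN₂, h₂⟩ := h.exists_excess_le M (ε / 2) (by simpa using hε)
  refine ⟨max N₁ N₂, le_max_of_le_left hN₁, fun P hP => ?_⟩
  calc ∫⁻ ω, ENNReal.ofReal (integrandUpper φ M ω - max N₁ N₂) ∂(P : Measure Ω)
      ≤ ∫⁻ ω, (ENNReal.ofReal (φ ω (-M) - N₁) + ENNReal.ofReal (φ ω M - N₂))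
          ∂(P : Measure Ω) := lintegral_mono fun ω => by
        rcases le_total (φ ω (-M)) (φ ω M) with hle | hle
        · refine le_trans ?_ le_add_self
          rw [integrandUpper, max_eq_right hle]
          exact ENNReal.ofReal_le_ofReal (by linarith [le_max_right N₁ N₂])
        · refine le_trans ?_ le_self_add
          rw [integrandUpper, max_eq_left hle]
          exact ENNReal.ofReal_le_ofReal (by linarith [le_max_left N₁ N₂])
    _ ≤ ε / 2 + ε / 2 := by
        have := h.measurable_left M
        rw [lintegral_add_right _ (by fun_prop)]
        exact add_le_add (h₁ P hP) (h₂ P hP)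
    _ = ε := ENNReal.add_halves ε

theorem exists_upper_le (M : ℝ) : ∃ C : ℝ≥0∞, C ≠ ∞ ∧
    ∀ P ∈ 𝒬, ∫⁻ ω, ENNReal.ofReal (integrandUpper φ M ω) ∂(P : Measure Ω) ≤ C := by
  obtain ⟨N, hN, hle⟩ := h.exists_excess_upper_le M one_ne_zero
  refine ⟨1 + ENNReal.ofReal N, by simp, fun P hP => ?_⟩
  calc ∫⁻ ω, ENNReal.ofReal (integrandUpper φ M ω) ∂(P : Measure Ω)
      ≤ ∫⁻ ω, (ENNReal.ofReal (integrandUpper φ M ω - N) + ENNReal.ofReal N)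
          ∂(P : Measure Ω) := lintegral_mono fun ω => by
        refine le_trans (le_of_eq ?_) ENNReal.ofReal_add_le
        rw [sub_add_cancel]
    _ ≤ _ := by
        rw [lintegral_add_right _ measurable_const]
        simpa using hle P hP

theorem exists_envelope_le (M : ℝ) : ∃ C : ℝ≥0∞, C ≠ ∞ ∧
    ∀ P ∈ 𝒬, ∫⁻ ω, ENNReal.ofReal (integrandEnvelope φ M ω) ∂(P : Measure Ω) ≤ C := by
  obtain ⟨C₁, hC₁, h₁⟩ := h.exists_upper_le M
  obtain ⟨C₂, hC₂, h₂⟩ := h.exists_neg_le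
  refine ⟨C₁ + 2 * C₂, ENNReal.add_ne_top.2 ⟨hC₁, ENNReal.mul_ne_top (by simp) hC₂⟩,
    fun P hP => ?_⟩
  have : ∀ ω, ENNReal.ofReal (integrandEnvelope φ M ω) =
      ENNReal.ofReal (integrandUpper φ M ω) + 2 * ENNReal.ofReal (-φ ω 0) := fun ω => by
    rw [integrandEnvelope, ENNReal.ofReal_add (by positivity) (by positivity),
      ENNReal.ofReal_mul (by norm_num)]
    simp [ENNReal.ofReal_max]
  simp_rw [this]
  have hm := h.measurable_left 0
  rw [lintegral_add_right _ (by fun_prop), lintegral_const_mul _ (by fun_prop)]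
  gcongr
  · exact h₁ P hP
  · exact h₂ P hP

theorem integrable_integrandEnvelope (M : ℝ) {P : ProbabilityMeasure Ω} (hP : P ∈ 𝒬) :
    Integrable (integrandEnvelope φ M) (P : Measure Ω) := by
  obtain ⟨C, hC, hle⟩ := h.exists_envelope_le M
  refine ⟨(h.measurable_integrandEnvelope M).aestronglyMeasurable, ?_⟩
  rw [hasFiniteIntegral_iff_ofReal (Eventually.of_forall fun ω => by
    unfold integrandEnvelope; positivity)]
  exact (hle P hP).trans_lt hC.lt_top

theorem integrable_comp {M : ℝ} {u : Ω → ℝ} (hu : Measurable u) (hM : ∀ ω, |u ω| ≤ M)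
    {P : ProbabilityMeasure Ω} (hP : P ∈ 𝒬) :
    Integrable (fun ω => φ ω (u ω)) (P : Measure Ω) :=
  (h.integrable_integrandEnvelope M hP).mono' (h.measurable_comp hu).aestronglyMeasurable
    (Eventually.of_forall fun ω => h.abs_le_integrandEnvelope (hM ω) ω)

theorem integrable_comp_bcf (f : Ω →ᵇ ℝ) {P : ProbabilityMeasure Ω} (hP : P ∈ 𝒬) :
    Integrable (fun ω => φ ω (f ω)) (P : Measure Ω) :=
  h.integrable_comp f.continuous.measurable f.norm_coe_le_norm hP

end RobustIntegrand

/-! ### Expectations over the set of measures: mixtures, semicontinuity, maximizers -/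

theorem erealExpectation_coe {Ω : Type*} [MeasurableSpace Ω] {P : ProbabilityMeasure Ω}
    {g : Ω → ℝ} (hg : Integrable g (P : Measure Ω)) :
    erealExpectation P (fun ω => (g ω : EReal)) = ((∫ ω, g ω ∂(P : Measure Ω) : ℝ) : EReal) := by
  have h1 : ∫⁻ ω, ENNReal.ofReal (g ω) ∂(P : Measure Ω) ≠ ∞ := hg.lintegral_lt_top.ne
  have h2 : ∫⁻ ω, ENNReal.ofReal (-g ω) ∂(P : Measure Ω) ≠ ∞ := hg.neg.lintegral_lt_top.ne
  rw [integral_eq_lintegral_pos_part_sub_lintegral_neg_part hg, EReal.coe_sub,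
    EReal.coe_ennreal_toReal h1, EReal.coe_ennreal_toReal h2]
  simp only [erealExpectation, ← EReal.coe_neg, EReal.toENNReal_of_ne_top (EReal.coe_ne_top _),
    EReal.toReal_coe]

/-- Mixtures of probability measures in a set that is convex as a set of signed measures. -/
theorem exists_mem_integral_eq_of_convex {Ω : Type*} [MeasurableSpace Ω]
    {𝒬 : Set (ProbabilityMeasure Ω)}
    (h𝒬 : Convex ℝ ((fun P : ProbabilityMeasure Ω => (P : Measure Ω).toSignedMeasure) '' 𝒬))
    {P₁ P₂ : ProbabilityMeasure Ω} (h₁ : P₁ ∈ 𝒬) (h₂ : P₂ ∈ 𝒬) {a b : ℝ} (ha : 0 ≤ a)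
    (hb : 0 ≤ b) (hab : a + b = 1) :
    ∃ P ∈ 𝒬, ∀ g : Ω → ℝ, Integrable g (P₁ : Measure Ω) → Integrable g (P₂ : Measure Ω) →
      ∫ ω, g ω ∂(P : Measure Ω) =
        a * ∫ ω, g ω ∂(P₁ : Measure Ω) + b * ∫ ω, g ω ∂(P₂ : Measure Ω) := by
  obtain ⟨P, hP, hPeq⟩ := h𝒬 (mem_image_of_mem _ h₁) (mem_image_of_mem _ h₂) ha hb hab
  have hmeas : (P : Measure Ω) =
      ENNReal.ofReal a • (P₁ : Measure Ω) + ENNReal.ofReal b • (P₂ : Measure Ω) := by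
    ext s hs
    have := congrArg (fun ν : SignedMeasure Ω => ν s) hPeq
    simp only [add_apply, smul_apply,
      Measure.toSignedMeasure_apply_measurable hs, smul_eq_mul, Measure.real] at this
    rw [← ENNReal.ofReal_toReal (measure_ne_top (P : Measure Ω) s), this,
      ENNReal.ofReal_add (by positivity) (by positivity), ENNReal.ofReal_mul ha,
      ENNReal.ofReal_mul hb]
    simp
  refine ⟨P, hP, fun g hg₁ hg₂ => ?_⟩
  rw [hmeas, integral_add_measure (hg₁.smul_measure ENNReal.ofReal_ne_top)
    (hg₂.smul_measure ENNReal.ofReal_ne_top), integral_smul_measure, integral_smul_measure,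
    ENNReal.toReal_ofReal ha, ENNReal.toReal_ofReal hb, smul_eq_mul, smul_eq_mul]

namespace RobustIntegrand

variable {Ω : Type*} [TopologicalSpace Ω] [MeasurableSpace Ω] [BorelSpace Ω]
  {𝒬 : Set (ProbabilityMeasure Ω)} {φ : Ω → ℝ → ℝ} (h : RobustIntegrand 𝒬 φ)
include h

/-- The expectation of the integrand is weakly upper semicontinuous on `𝒬`. -/
theorem upperSemicontinuousOn_integral [PolishSpace Ω] (f : Ω →ᵇ ℝ) :
    UpperSemicontinuousOn
      (fun P : ProbabilityMeasure Ω => ∫ ω, φ ω (f ω) ∂(P : Measure Ω)) 𝒬 := by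
  intro P hP c hc
  by_contra hcon
  obtain ⟨Ps, hPs, hPs'⟩ := exists_seq_forall_of_frequently
    ((not_eventually.1 hcon).and_eventually eventually_mem_nhdsWithin)
  dsimp only at hc hPs'
  obtain ⟨ε, hε, hεc⟩ : ∃ ε : ℝ, 0 < ε ∧ ∫ ω, φ ω (f ω) ∂(P : Measure Ω) + ε < c :=
    ⟨(c - ∫ ω, φ ω (f ω) ∂(P : Measure Ω)) / 2, by linarith, by linarith⟩
  obtain ⟨N₀, hN₀, hexc⟩ := h.exists_excess_upper_le ‖f‖ (ε := ENNReal.ofReal ε) (by simpa using hε)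
  -- `N ≥ N₀` makes the excess over `N` at most `ε`, and `N ≥ c` keeps `N - c + ε` nonnegative for
  -- the comparison under `ENNReal.ofReal`. The semicontinuity lemma is applied to the nonnegative
  -- function `(N - G)⁺`, which differs from `N - G` by the small excess `(G - N)⁺`.
  set N := max N₀ c
  set G : Ω → ℝ := fun ω => φ ω (f ω) with hG
  have hGm : Measurable G := h.measurable_comp f.continuous.measurable
  have key : ∀ P' : ProbabilityMeasure Ω, P' ∈ 𝒬 →
      ∫ ω, max (N - G ω) 0 ∂(P' : Measure Ω) =
        N - ∫ ω, G ω ∂(P' : Measure Ω) + ∫ ω, max (G ω - N) 0 ∂(P' : Measure Ω) ∧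
      ∫ ω, max (G ω - N) 0 ∂(P' : Measure Ω) ≤ ε ∧
      ENNReal.ofReal (∫ ω, max (N - G ω) 0 ∂(P' : Measure Ω)) =
        ∫⁻ ω, ENNReal.ofReal (max (N - G ω) 0) ∂(P' : Measure Ω) := by
    intro P' hP'
    have hi : Integrable G (P' : Measure Ω) := h.integrable_comp_bcf f hP'
    have hi1 : Integrable (fun ω => max (G ω - N) 0) (P' : Measure Ω) :=
      (hi.sub (integrable_const N)).pos_part
    have hi2 : Integrable (fun ω => max (N - G ω) 0) (P' : Measure Ω) :=
      ((integrable_const N).sub hi).pos_part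
    refine ⟨?_, ?_, ofReal_integral_eq_lintegral_ofReal hi2
      (Eventually.of_forall fun ω => le_max_right _ _)⟩
    · have e1 : N - ∫ ω, G ω ∂(P' : Measure Ω) = ∫ ω, (N - G ω) ∂(P' : Measure Ω) := by
        rw [integral_sub (integrable_const N) hi]; simp
      rw [e1, ← integral_add _ hi1]
      · refine integral_congr_ae (Eventually.of_forall fun ω => ?_)
        dsimp only
        rcases le_total (G ω) N with h' | h'
        · rw [max_eq_left (by linarith), max_eq_right (by linarith)]; ring
        · rw [max_eq_right (by linarith), max_eq_left (by linarith)]; ring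
      · exact (integrable_const N).sub hi
    · rw [← ENNReal.ofReal_le_ofReal_iff hε.le, ofReal_integral_eq_lintegral_ofReal hi1
        (Eventually.of_forall fun ω => le_max_right _ _)]
      refine (lintegral_mono fun ω => ?_).trans (hexc P' hP')
      rw [ENNReal.ofReal_max, ENNReal.ofReal_zero, max_eq_left zero_le]
      exact ENNReal.ofReal_le_ofReal (sub_le_sub (h.le_integrandUpper (f.norm_coe_le_norm ω) ω)
        (le_max_left _ _))
  have hlsc : LowerSemicontinuous fun ω => max (N - G ω) 0 := by
    intro ω c' hc'
    rcases lt_max_iff.1 hc' with hc'' | hc''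
    · filter_upwards [h.usc_comp f.continuous ω (N - c') (by linarith)] with ω' hω'
      exact lt_max_of_lt_left (by linarith)
    · exact Eventually.of_forall fun ω' => lt_max_of_lt_right hc''
  have hlim := hlsc.lintegral_ofReal_le_liminf (hPs.mono_right nhdsWithin_le_nhds)
    (fun ω => le_max_right _ _)
  have hle : atTop.liminf (fun i => ∫⁻ ω, ENNReal.ofReal (max (N - G ω) 0) ∂(Ps i : Measure Ω)) ≤
      ENNReal.ofReal (N - c + ε) := by
    refine (liminf_le_liminf (v := fun _ => ENNReal.ofReal (N - c + ε))
      (Eventually.of_forall fun i => ?_)).trans (by simp)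
    obtain ⟨e1, e2, e3⟩ := key (Ps i) (hPs' i).2
    rw [← e3]
    exact ENNReal.ofReal_le_ofReal (by linarith [not_lt.1 (hPs' i).1])
  obtain ⟨e1, -, e3⟩ := key P hP
  have e4 : 0 ≤ ∫ ω, max (G ω - N) 0 ∂(P : Measure Ω) :=
    integral_nonneg fun ω => le_max_right _ _
  have := hlim.trans hle
  rw [← e3, ENNReal.ofReal_le_ofReal_iff (by linarith [le_max_right N₀ c])] at this
  linarith

theorem robustIntegral_eq (f : Ω →ᵇ ℝ) :
    robustIntegral φ 𝒬 f = ⨆ P ∈ 𝒬, ((∫ ω, φ ω (f ω) ∂(P : Measure Ω) : ℝ) : EReal) :=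
  biSup_congr fun _ hP => erealExpectation_coe (h.integrable_comp_bcf f hP)

theorem exists_robustIntegral_eq [PolishSpace Ω] (hne : 𝒬.Nonempty) (hc : IsCompact 𝒬)
    (f : Ω →ᵇ ℝ) : ∃ P ∈ 𝒬,
      robustIntegral φ 𝒬 f = ((∫ ω, φ ω (f ω) ∂(P : Measure Ω) : ℝ) : EReal) := by
  obtain ⟨P, hP, hmax⟩ := (h.upperSemicontinuousOn_integral f).exists_isMaxOn hne hc
  refine ⟨P, hP, ?_⟩
  rw [h.robustIntegral_eq]
  exact le_antisymm (iSup₂_le fun P' hP' => EReal.coe_le_coe_iff.2 (hmax hP'))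
    (le_iSup₂ (f := fun (P : ProbabilityMeasure Ω) (_ : P ∈ 𝒬) =>
      ((∫ ω, φ ω (f ω) ∂(P : Measure Ω) : ℝ) : EReal)) P hP)

/-- Translating the second variable by a bounded continuous function. -/
theorem translate (g : Ω →ᵇ ℝ) : RobustIntegrand 𝒬 fun ω x => φ ω (g ω + x) where
  convexOn ω := by
    have := (h.convexOn ω).translate_right (g ω)
    rwa [preimage_univ] at this
  usc x := h.usc_comp (g.continuous.add continuous_const)
  exists_excess_le x ε hε := by
    obtain ⟨N, hN, hle⟩ := h.exists_excess_upper_le (‖g‖ + |x|) hε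
    refine ⟨N, hN, fun P hP => (lintegral_mono fun ω => ENNReal.ofReal_le_ofReal ?_).trans
      (hle P hP)⟩
    gcongr
    exact h.le_integrandUpper ((abs_add_le _ _).trans (by gcongr; exact g.norm_coe_le_norm ω)) ω
  exists_neg_le := by
    obtain ⟨C, hC, hle⟩ := h.exists_envelope_le ‖g‖
    refine ⟨C, hC, fun P hP => (lintegral_mono fun ω => ENNReal.ofReal_le_ofReal ?_).trans
      (hle P hP)⟩
    rw [add_zero]
    exact (neg_le_abs _).trans (h.abs_le_integrandEnvelope (g.norm_coe_le_norm ω) ω)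

end RobustIntegrand

/-! ### Conjugate duality for a single probability measure -/

theorem erealExpectation_mono {Ω : Type*} [MeasurableSpace Ω] (P : ProbabilityMeasure Ω)
    {g₁ g₂ : Ω → EReal} (hle : ∀ᵐ ω ∂(P : Measure Ω), g₁ ω ≤ g₂ ω) :
    erealExpectation P g₁ ≤ erealExpectation P g₂ :=
  EReal.sub_le_sub
    (EReal.coe_ennreal_le_coe_ennreal_iff.2 (lintegral_mono_ae (hle.mono fun _ h =>
      EReal.toENNReal_le_toENNReal h)))
    (EReal.coe_ennreal_le_coe_ennreal_iff.2 (lintegral_mono_ae (hle.mono fun _ h =>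
      EReal.toENNReal_le_toENNReal (EReal.neg_le_neg_iff.2 h))))

theorem le_integrandConj {Ω : Type*} (φ : Ω → ℝ → ℝ) (ω : Ω) (x y : ℝ) :
    ((x * y - φ ω x : ℝ) : EReal) ≤ integrandConj φ ω y :=
  le_iSup (fun x : ℝ => ((x * y - φ ω x : ℝ) : EReal)) x

/-- Bounded measurable functions are almost everywhere limits of uniformly bounded sequences of
continuous functions. -/
theorem exists_seq_bcf_tendsto_ae {Ω : Type*} [TopologicalSpace Ω] [PolishSpace Ω]
    [MeasurableSpace Ω] [BorelSpace Ω] (m : Measure Ω) [IsFiniteMeasure m] {u : Ω → ℝ}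
    (hu : Measurable u) {M : ℝ} (hM : ∀ ω, |u ω| ≤ M) :
    ∃ f : ℕ → Ω →ᵇ ℝ, (∀ n ω, |f n ω| ≤ M) ∧
      ∀ᵐ ω ∂m, Tendsto (fun n => f n ω) atTop (𝓝 (u ω)) := by
  rcases isEmpty_or_nonempty Ω with hΩ | ⟨⟨ω₀⟩⟩
  · exact ⟨fun _ => 0, fun _ ω => hΩ.elim ω, Eventually.of_forall fun ω => hΩ.elim ω⟩
  have hM0 : 0 ≤ M := (abs_nonneg _).trans (hM ω₀)
  have hint : MemLp u 1 m := memLp_one_iff_integrable.2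
    (Integrable.of_bound hu.aestronglyMeasurable M (Eventually.of_forall hM))
  have happ : ∀ n : ℕ, ∃ g : Ω →ᵇ ℝ, eLpNorm (u - (g : Ω → ℝ)) 1 m ≤ ((n : ℝ≥0∞) + 1)⁻¹ := fun n => by
    obtain ⟨g, hg, -⟩ := hint.exists_boundedContinuous_eLpNorm_sub_le ENNReal.one_ne_top
      (ε := ((n : ℝ≥0∞) + 1)⁻¹) (by simp)
    exact ⟨g, hg⟩
  choose g hg using happ
  have hlim : Tendsto (fun n => eLpNorm ((g n : Ω → ℝ) - u) 1 m) atTop (𝓝 0) := by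
    refine tendsto_of_tendsto_of_tendsto_of_le_of_le tendsto_const_nhds
      (h := fun n : ℕ => ((n : ℝ≥0∞) + 1)⁻¹) ?_ (fun _ => zero_le)
      (fun n => (eLpNorm_sub_comm _ _ _ _).trans_le (hg n))
    have := (tendsto_add_atTop_iff_nat 1).2 ENNReal.tendsto_inv_nat_nhds_zero
    simpa using this
  obtain ⟨ns, -, hns⟩ := (tendstoInMeasure_of_tendsto_eLpNorm one_ne_zero
    (fun n => (g n).continuous.measurable.aestronglyMeasurable) hu.aestronglyMeasurable
    hlim).exists_seq_tendsto_ae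
  -- Truncation to `[-M, M]` restores the uniform bound and fixes the limit `u`.
  have hclip : ∀ x : ℝ, |max (-M) (min M x)| ≤ M := fun x =>
    abs_le.2 ⟨le_max_left _ _, max_le (by linarith) (min_le_left _ _)⟩
  refine ⟨fun n => BoundedContinuousFunction.ofNormedAddCommGroup
    (fun ω => max (-M) (min M (g (ns n) ω))) (by fun_prop) M fun ω => hclip _,
    fun n ω => hclip _, hns.mono fun ω hω => ?_⟩
  have h1 : max (-M) (min M (u ω)) = u ω := by
    rw [min_eq_right (abs_le.1 (hM ω)).2, max_eq_right (abs_le.1 (hM ω)).1]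
  have := (tendsto_const_nhds (x := -M)).max ((tendsto_const_nhds (x := M)).min hω)
  rwa [h1] at this

/-- A maximizing selection of `x ↦ x y - φ(ω, x)` among the first `n` terms of a dense sequence. -/
noncomputable def conjSelection {Ω : Type*} (φ : Ω → ℝ → ℝ) (η : Ω → ℝ) : ℕ → Ω → ℝ
  | 0, _ => 0
  | n + 1, ω =>
    if conjSelection φ η n ω * η ω - φ ω (conjSelection φ η n ω) <
        TopologicalSpace.denseSeq ℝ n * η ω - φ ω (TopologicalSpace.denseSeq ℝ n)
    then TopologicalSpace.denseSeq ℝ n else conjSelection φ η n ω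

/-- Each selection takes only finitely many values. -/
theorem conjSelection_bound {Ω : Type*} (φ : Ω → ℝ → ℝ) (η : Ω → ℝ) (n : ℕ) :
    ∃ M, ∀ ω, |conjSelection φ η n ω| ≤ M := by
  induction n with
  | zero => exact ⟨0, fun ω => by simp [conjSelection]⟩
  | succ n ih =>
    obtain ⟨M, hM⟩ := ih
    refine ⟨max M |TopologicalSpace.denseSeq ℝ n|, fun ω => ?_⟩
    rw [conjSelection]
    split_ifs
    · exact le_max_right _ _
    · exact (hM ω).trans (le_max_left _ _)

theorem conjSelection_value_monotone {Ω : Type*} (φ : Ω → ℝ → ℝ) (η : Ω → ℝ) (ω : Ω) :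
    Monotone fun n => conjSelection φ η n ω * η ω - φ ω (conjSelection φ η n ω) := by
  refine monotone_nat_of_le_succ fun n => ?_
  conv_rhs => rw [conjSelection]
  split_ifs with hlt
  · exact hlt.le
  · exact le_rfl

namespace RobustIntegrand

variable {Ω : Type*} [TopologicalSpace Ω] [MeasurableSpace Ω] [BorelSpace Ω]
  {𝒬 : Set (ProbabilityMeasure Ω)} {φ : Ω → ℝ → ℝ} (h : RobustIntegrand 𝒬 φ)
include h

theorem measurable_conjSelection {η : Ω → ℝ} (hη : Measurable η) (n : ℕ) :
    Measurable (conjSelection φ η n) := by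
  induction n with
  | zero => exact measurable_const
  | succ n ih =>
    have h1 := h.measurable_comp ih
    have h2 := h.measurable_left (TopologicalSpace.denseSeq ℝ n)
    exact Measurable.ite (measurableSet_lt ((ih.mul hη).sub h1) ((hη.const_mul _).sub h2))
      measurable_const ih

-- By continuity of `φ ω`, the supremum defining the conjugate may be taken over a dense sequence.
omit [BorelSpace Ω] in
theorem tendsto_conjSelection (η : Ω → ℝ) (ω : Ω) :
    Tendsto (fun n => ((conjSelection φ η n ω * η ω - φ ω (conjSelection φ η n ω) : ℝ) : EReal))
      atTop (𝓝 (integrandConj φ ω (η ω))) := by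
  have hmono : Monotone fun n =>
      ((conjSelection φ η n ω * η ω - φ ω (conjSelection φ η n ω) : ℝ) : EReal) :=
    fun m n hmn => EReal.coe_le_coe_iff.2 (conjSelection_value_monotone φ η ω hmn)
  convert tendsto_atTop_iSup hmono using 2
  refine le_antisymm (iSup_le fun x => ?_) (iSup_le fun n => le_integrandConj φ ω _ _)
  refine (TopologicalSpace.denseRange_denseSeq ℝ).induction_on
    (p := fun x : ℝ => ((x * η ω - φ ω x : ℝ) : EReal) ≤ _) x ?_ fun n => ?_
  · have := h.continuous ω
    exact isClosed_le (continuous_coe_real_ereal.comp (by fun_prop)) continuous_const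
  · refine le_trans (EReal.coe_le_coe_iff.2 ?_) (le_iSup (fun n =>
      ((conjSelection φ η n ω * η ω - φ ω (conjSelection φ η n ω) : ℝ) : EReal)) (n + 1))
    rw [conjSelection]
    split_ifs with hlt
    · exact le_rfl
    · exact not_lt.1 hlt

/-- Young's inequality, integrated against `P`. -/
theorem caPairing_sub_le_divergence (f : Ω →ᵇ ℝ) (ν : SignedMeasure Ω)
    {P : ProbabilityMeasure Ω} (hP : P ∈ 𝒬) :
    ((caPairing Ω f ν - ∫ ω, φ ω (f ω) ∂(P : Measure Ω) : ℝ) : EReal) ≤ divergence φ ν P := by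
  unfold divergence
  split_ifs with hac
  · have hη := SignedMeasure.integrable_rnDeriv ν (P : Measure Ω)
    have hi : Integrable (fun ω => f ω * ν.rnDeriv (P : Measure Ω) ω) (P : Measure Ω) :=
      hη.bdd_mul f.continuous.measurable.aestronglyMeasurable
        (Eventually.of_forall f.norm_coe_le_norm)
    have hi2 := h.integrable_comp_bcf f hP
    nth_rewrite 1 [← SignedMeasure.withDensityᵥ_rnDeriv_eq ν (P : Measure Ω) hac]
    rw [caPairing_withDensityᵥ f _ hη (SignedMeasure.measurable_rnDeriv _ _),
      ← integral_sub hi hi2]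
    refine (erealExpectation_coe (hi.sub hi2)).symm.trans_le ?_
    exact erealExpectation_mono P (Eventually.of_forall fun ω => le_integrandConj φ ω _ _)
  · exact le_top

/-- Bounded continuous functions do as well as bounded measurable ones. -/
theorem exists_bcf_lt [PolishSpace Ω] (μ₁ μ₂ : Measure Ω) [IsFiniteMeasure μ₁]
    [IsFiniteMeasure μ₂] {P : ProbabilityMeasure Ω} (hP : P ∈ 𝒬) {u : Ω → ℝ} (hu : Measurable u)
    {M : ℝ} (hM : ∀ ω, |u ω| ≤ M) {c : ℝ}
    (hc : c < ∫ ω, u ω ∂μ₁ - ∫ ω, u ω ∂μ₂ - ∫ ω, φ ω (u ω) ∂(P : Measure Ω)) :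
    ∃ f : Ω →ᵇ ℝ, c < caPairing Ω f (μ₁.toSignedMeasure - μ₂.toSignedMeasure) -
      ∫ ω, φ ω (f ω) ∂(P : Measure Ω) := by
  -- Using the sum of the three measures gives one sequence that converges almost everywhere for
  -- each of them, even when they are mutually singular.
  obtain ⟨f, hfM, hf⟩ := exists_seq_bcf_tendsto_ae (μ₁ + μ₂ + (P : Measure Ω)) hu hM
  rw [ae_add_measure_iff, ae_add_measure_iff] at hf
  have hlin : ∀ μ : Measure Ω, IsFiniteMeasure μ →
      (∀ᵐ ω ∂μ, Tendsto (fun n => f n ω) atTop (𝓝 (u ω))) →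
      Tendsto (fun n => ∫ ω, f n ω ∂μ) atTop (𝓝 (∫ ω, u ω ∂μ)) := fun μ _ hμ =>
    tendsto_integral_of_dominated_convergence (fun _ => M)
      (fun n => (f n).continuous.measurable.aestronglyMeasurable) (integrable_const M)
      (fun n => Eventually.of_forall (hfM n)) hμ
  have hφ : Tendsto (fun n => ∫ ω, φ ω (f n ω) ∂(P : Measure Ω)) atTop
      (𝓝 (∫ ω, φ ω (u ω) ∂(P : Measure Ω))) :=
    tendsto_integral_of_dominated_convergence (integrandEnvelope φ M)
      (fun n => (h.measurable_comp (f n).continuous.measurable).aestronglyMeasurable)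
      (h.integrable_integrandEnvelope M hP)
      (fun n => Eventually.of_forall fun ω => h.abs_le_integrandEnvelope (hfM n ω) ω)
      (hf.2.mono fun ω hω => ((h.continuous ω).tendsto _).comp hω)
  have hlim := ((hlin μ₁ inferInstance hf.1.1).sub (hlin μ₂ inferInstance hf.1.2)).sub hφ
  obtain ⟨n, hn⟩ := (hlim.eventually (lt_mem_nhds hc)).exists
  exact ⟨f n, by rwa [caPairing_toSignedMeasure_sub]⟩

theorem exists_bcf_lt_of_not_absolutelyContinuous [PolishSpace Ω] {ν : SignedMeasure Ω}
    {P : ProbabilityMeasure Ω} (hP : P ∈ 𝒬)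
    (hac : ¬ν ≪ᵥ (P : Measure Ω).toENNRealVectorMeasure) (c : ℝ) :
    ∃ f : Ω →ᵇ ℝ, c < caPairing Ω f ν - ∫ ω, φ ω (f ω) ∂(P : Measure Ω) := by
  simp only [VectorMeasure.AbsolutelyContinuous, not_forall] at hac
  obtain ⟨s, hPs, hνs⟩ := hac
  have hs : MeasurableSet s := by
    by_contra hs
    exact hνs (ν.not_measurable hs)
  rw [Measure.toENNRealVectorMeasure_apply_measurable hs] at hPs
  set μ₁ := ν.toJordanDecomposition.posPart
  set μ₂ := ν.toJordanDecomposition.negPart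
  have hν : ν = μ₁.toSignedMeasure - μ₂.toSignedMeasure :=
    (SignedMeasure.toSignedMeasure_toJordanDecomposition ν).symm
  have hνs' : ν s = μ₁.real s - μ₂.real s := by
    rw [hν, Measure.toSignedMeasure_sub_apply hs]
  -- With this `k`, the function `k 1_s` pairs with `ν` to `c + E_P[φ(·, 0)] + 1`, while under `P`
  -- it is indistinguishable from `0`.
  set k : ℝ := (c + ∫ ω, φ ω 0 ∂(P : Measure Ω) + 1) / ν s
  have hφ : ∫ ω, φ ω (s.indicator (fun _ => k) ω) ∂(P : Measure Ω) =
      ∫ ω, φ ω 0 ∂(P : Measure Ω) := by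
    refine integral_congr_ae ((measure_eq_zero_iff_ae_notMem.1 hPs).mono fun ω hω => ?_)
    simp [hω]
  rw [hν]
  refine h.exists_bcf_lt μ₁ μ₂ hP (u := s.indicator fun _ => k)
    (measurable_const.indicator hs) (M := |k|) (fun ω => ?_) ?_
  · by_cases hω : ω ∈ s <;> simp [hω]
  · rw [hφ, integral_indicator_const _ hs, integral_indicator_const _ hs, smul_eq_mul, smul_eq_mul,
      ← sub_mul, ← hνs', mul_div_cancel₀ _ hνs]
    linarith

theorem exists_bcf_lt_of_lt_divergence [PolishSpace Ω] {ν : SignedMeasure Ω}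
    {P : ProbabilityMeasure Ω} (hP : P ∈ 𝒬) {c : ℝ} (hc : (c : EReal) < divergence φ ν P) :
    ∃ f : Ω →ᵇ ℝ, c < caPairing Ω f ν - ∫ ω, φ ω (f ω) ∂(P : Measure Ω) := by
  by_cases hac : ν ≪ᵥ (P : Measure Ω).toENNRealVectorMeasure
  swap
  · exact h.exists_bcf_lt_of_not_absolutelyContinuous hP hac c
  rw [divergence, if_pos hac] at hc
  by_contra! hcon
  refine hc.not_ge ?_
  set η := ν.rnDeriv (P : Measure Ω)
  have hη : Integrable η (P : Measure Ω) := SignedMeasure.integrable_rnDeriv _ _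
  have hηm : Measurable η := SignedMeasure.measurable_rnDeriv _ _
  have h1 := isFiniteMeasure_withDensity_ofReal hη.2
  have h2 := isFiniteMeasure_withDensity_ofReal hη.neg.2
  have hν := (SignedMeasure.withDensityᵥ_rnDeriv_eq ν (P : Measure Ω) hac).symm
  rw [withDensityᵥ_eq_withDensity_pos_part_sub_withDensity_neg_part hη] at hν
  set ζ : ℕ → Ω → ℝ := fun n ω => conjSelection φ η n ω * η ω - φ ω (conjSelection φ η n ω)
  have hζm : ∀ n, Measurable (ζ n) := fun n =>
    ((h.measurable_conjSelection hηm n).mul hηm).sub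
      (h.measurable_comp (h.measurable_conjSelection hηm n))
  have hζint : ∀ n, Integrable (ζ n) (P : Measure Ω) ∧ ∫ ω, ζ n ω ∂(P : Measure Ω) ≤ c := by
    intro n
    obtain ⟨M, hM⟩ := conjSelection_bound φ η n
    have hm := h.measurable_conjSelection hηm n
    have hi : Integrable (fun ω => conjSelection φ η n ω * η ω) (P : Measure Ω) :=
      hη.bdd_mul hm.aestronglyMeasurable (Eventually.of_forall hM)
    have hi2 := h.integrable_comp hm hM hP
    refine ⟨hi.sub hi2, ?_⟩
    rw [integral_sub hi hi2, ← integral_withDensity_pos_sub_neg _ hη hηm hm hM]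
    by_contra! hlt
    obtain ⟨f, hf⟩ := h.exists_bcf_lt _ _ hP hm hM hlt
    have := hcon f
    rw [hν] at this
    exact absurd hf (not_lt.2 this)
  have hζlim := h.tendsto_conjSelection η
  have hmono : ∀ ω, Monotone fun n => (ζ n ω : EReal) := fun ω m n hmn =>
    EReal.coe_le_coe_iff.2 (conjSelection_value_monotone φ η ω hmn)
  have hA := lintegral_tendsto_of_tendsto_of_monotone (μ := (P : Measure Ω))
    (f := fun n ω => (ζ n ω : EReal).toENNReal)
    (F := fun ω => (integrandConj φ ω (η ω)).toENNReal)
    (fun n => (measurable_coe_real_ereal.comp (hζm n)).ereal_toENNReal.aemeasurable)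
    (Eventually.of_forall fun ω m n hmn => EReal.toENNReal_le_toENNReal (hmono ω hmn))
    (Eventually.of_forall fun ω => (EReal.continuous_toENNReal.tendsto _).comp (hζlim ω))
  have hB0 : ∫⁻ ω, (-(ζ 0 ω : EReal)).toENNReal ∂(P : Measure Ω) ≠ ∞ := by
    have := (hζint 0).1.neg.lintegral_lt_top.ne
    simpa only [← EReal.coe_neg, EReal.toENNReal_of_ne_top (EReal.coe_ne_top _),
      EReal.toReal_coe, Pi.neg_apply] using this
  have hBanti : ∀ ω, Antitone fun n => (-(ζ n ω : EReal)).toENNReal := fun ω m n hmn =>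
    EReal.toENNReal_le_toENNReal (EReal.neg_le_neg_iff.2 (hmono ω hmn))
  -- The negative parts decrease from that of `-φ(·, 0)`, which is integrable. Their limit is
  -- therefore finite, and the difference with the possibly infinite positive part is continuous in
  -- `EReal`.
  have hB := lintegral_tendsto_of_tendsto_of_antitone (μ := (P : Measure Ω))
    (f := fun n ω => (-(ζ n ω : EReal)).toENNReal)
    (F := fun ω => (-integrandConj φ ω (η ω)).toENNReal)
    (fun n => (measurable_coe_real_ereal.comp (hζm n)).neg.ereal_toENNReal.aemeasurable)
    (Eventually.of_forall hBanti) hB0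
    (Eventually.of_forall fun ω => (EReal.continuous_toENNReal.tendsto _).comp (hζlim ω).neg)
  have hBfin : ∫⁻ ω, (-integrandConj φ ω (η ω)).toENNReal ∂(P : Measure Ω) ≠ ∞ :=
    ne_top_of_le_ne_top hB0 (lintegral_mono fun ω =>
      EReal.toENNReal_le_toENNReal (EReal.neg_le_neg_iff.2 (le_integrandConj φ ω _ _)))
  have hA' := (continuous_coe_ennreal_ereal.tendsto _).comp hA
  have hB' := ((continuous_coe_ennreal_ereal.tendsto _).comp hB).neg
  have hsum := (EReal.continuousAt_add (p := (_, _)) (Or.inr ?_) (Or.inl ?_)).tendsto.comp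
    (hA'.prodMk_nhds hB')
  · refine le_of_tendsto hsum (Eventually.of_forall fun n => ?_)
    have := (erealExpectation_coe (hζint n).1).trans_le (EReal.coe_le_coe_iff.2 (hζint n).2)
    exact this
  · simpa using hBfin
  · exact EReal.coe_ennreal_ne_bot _

end RobustIntegrand

/-! ### Mackey continuity from subgradients -/

section Mackey

variable {E F : Type*} [AddCommGroup E] [Module ℝ E] [AddCommGroup F] [Module ℝ F]
  (B : E →ₗ[ℝ] F →ₗ[ℝ] ℝ)

/-- Scaled polars of the sets `K` are Mackey neighbourhoods of `0`, so control of the increments of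
`I` on one of them suffices. -/
theorem continuous_mackeyTopology_of_forall {I : E → ℝ}
    (h : ∀ e, ∀ ε > 0, ∃ K : Set F, AbsConvex ℝ K ∧ IsCompact (X := WeakBilin B.flip) K ∧
      ∃ δ > 0, ∀ g, (∀ ν ∈ K, |B g ν| ≤ δ) → |I (e + g) - I e| ≤ ε) :
    Continuous[mackeyTopology B, UniformSpace.toTopologicalSpace] I := by
  let := mackeyTopology B
  refine continuous_iff_continuousAt.2 fun e => ?_
  refine Metric.tendsto_nhds.2 fun ε hε => ?_
  obtain ⟨K, hK1, hK2, δ, hδ, hK⟩ := h e (ε / 2) (by positivity)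
  have hmem := UniformOnFun.gen_mem_nhds ℝ
    {K : Set F | AbsConvex ℝ K ∧ IsCompact (X := WeakBilin B.flip) K}
    (UniformOnFun.ofFun {K : Set F | AbsConvex ℝ K ∧ IsCompact (X := WeakBilin B.flip) K}
      fun y : F => B e y) (s := K) ⟨hK1, hK2⟩ (Metric.dist_mem_uniformity hδ)
  have hcont : Continuous (fun x : E => UniformOnFun.ofFun
      {K : Set F | AbsConvex ℝ K ∧ IsCompact (X := WeakBilin B.flip) K} (fun y : F => B x y)) :=
    continuous_induced_dom
  filter_upwards [hcont.continuousAt hmem] with f hf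
  have := hK (f - e) fun ν hν => by
    have := hf ν hν
    simp only [UniformOnFun.toFun_ofFun, Real.dist_eq] at this
    rw [map_sub, LinearMap.sub_apply, abs_sub_comm]
    exact this.le
  rw [add_sub_cancel] at this
  rw [Real.dist_eq]
  linarith

/-- A function with subgradients everywhere is controlled near `0` by the polar of a sublevel set
of its conjugate. -/
theorem abs_sub_le_of_subgradient {I : E → ℝ}
    (hsub : ∀ e, ∃ ν, ∀ f, B f ν - I f ≤ B e ν - I e) {K : Set F}
    (hK : ∀ ν, (∀ f, B f ν - I f ≤ 1 - I 0) → ν ∈ K) {ε : ℝ} (hε : 0 < ε) (hε1 : ε ≤ 1) {g : E}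
    (hg : ∀ ν ∈ K, |B g ν| ≤ ε / 2) : |I g - I 0| ≤ ε / 2 := by
  obtain ⟨ν₀, hν₀⟩ := hsub 0
  simp only [map_zero, LinearMap.zero_apply, zero_sub] at hν₀
  have hbound : ∀ g, (∀ ν ∈ K, |B g ν| ≤ 1 / 2) → I g - I 0 ≤ 1 / 2 := by
    intro g hg
    obtain ⟨ν, hν⟩ := hsub g
    have h0 := hν 0
    simp only [map_zero, LinearMap.zero_apply, zero_sub] at h0
    -- `d - I 0` is the value at `ν` of the conjugate of `I`. If `d > 1`, mixing `ν` with `ν₀` at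
    -- weight `d⁻¹` brings the conjugate down to `1 - I 0`; membership in `K` then gives `B g ν ≤
    -- d`, hence `I g ≤ I 0`.
    set d := B g ν - I g + I 0 with hd
    rcases le_or_gt d 1 with hd1 | hd1
    · have := (abs_le.1 (hg ν (hK ν fun f => (hν f).trans (by linarith)))).2
      linarith
    · have hd0 : 0 < d := by linarith
      have ht : d⁻¹ * d = 1 := inv_mul_cancel₀ hd0.ne'
      have ht0 : 0 < d⁻¹ := by positivity
      have ht1 : d⁻¹ ≤ 1 := inv_le_one_of_one_le₀ hd1.le
      have hmem : (1 - d⁻¹) • ν₀ + d⁻¹ • ν ∈ K := hK _ fun f => by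
        simp only [map_add, map_smul, smul_eq_mul]
        have h1 := mul_le_mul_of_nonneg_left (hν₀ f) (by linarith : 0 ≤ 1 - d⁻¹)
        have h2 := mul_le_mul_of_nonneg_left (hν f) ht0.le
        have h3 : d⁻¹ * (B g ν - I g) = 1 - d⁻¹ * I 0 := by rw [← ht, hd]; ring
        linarith
      have h1 := (abs_le.1 (hg _ hmem)).2
      simp only [map_add, map_smul, smul_eq_mul] at h1
      have h2 := (abs_le.1 (hg ν₀ (hK ν₀ fun f => (hν₀ f).trans (by linarith)))).1
      have h3 := mul_le_mul_of_nonneg_left h2 (by linarith : 0 ≤ 1 - d⁻¹)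
      have h4 : d⁻¹ * B g ν ≤ d⁻¹ * d := by rw [ht]; linarith
      have h5 := le_of_mul_le_mul_left h4 ht0
      linarith
  -- Convexity of `I` on the segment from `0` to `ε⁻¹ • g`, recovered from the subgradient at `g`,
  -- scales the bound by `ε`.
  have hscale : ∀ g, (∀ ν ∈ K, |B g ν| ≤ ε / 2) → I g - I 0 ≤ ε / 2 := by
    intro g hg
    have h1 := hbound (ε⁻¹ • g) fun ν hν => by
      rw [map_smul, LinearMap.smul_apply, smul_eq_mul, abs_mul, abs_of_pos (inv_pos.2 hε),
        inv_mul_le_iff₀ hε]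
      linarith [hg ν hν]
    obtain ⟨ν, hν⟩ := hsub g
    have h2 := hν 0
    have h3 := hν (ε⁻¹ • g)
    simp only [map_zero, LinearMap.zero_apply, map_smul, LinearMap.smul_apply, smul_eq_mul] at h2 h3
    have h4 := mul_le_mul_of_nonneg_left h3 hε.le
    have h5 := mul_le_mul_of_nonneg_left h2 (by linarith : 0 ≤ 1 - ε)
    have h6 := mul_le_mul_of_nonneg_left h1 hε.le
    have h7 : ε * (ε⁻¹ * B g ν) = B g ν := mul_inv_cancel_left₀ hε.ne' _
    linarith
  have h1 := hscale g hg
  have h2 := hscale (-g) fun ν hν => by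
    rw [map_neg, LinearMap.neg_apply, abs_neg]
    exact hg ν hν
  -- Adding the subgradient inequalities of `ν₀` at `g` and `-g` gives `2 I 0 ≤ I g + I (-g)`, which
  -- turns the upper bound at `-g` into a lower bound at `g`.
  have h3 := hν₀ g
  have h4 := hν₀ (-g)
  rw [map_neg, LinearMap.neg_apply] at h4
  rw [abs_le]
  constructor <;> linarith

end Mackey

/-! ### Weakly compact sets of signed measures -/

section Compactness

open scoped NNReal

variable {Ω : Type*} [TopologicalSpace Ω] [MeasurableSpace Ω] [BorelSpace Ω]

/-- The finite measures of mass at most `C` that give mass at most `u n` to the complement of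
`K n`. -/
def tightFiniteMeasures (C : ℝ≥0) (u : ℕ → ℝ≥0) (K : ℕ → Set Ω) : Set (FiniteMeasure Ω) :=
  {μ | μ.mass ≤ C ∧ ∀ n, μ (K n)ᶜ ≤ u n}

/-- The differences of two measures in `tightFiniteMeasures`. -/
def tightSignedMeasures (C : ℝ≥0) (u : ℕ → ℝ≥0) (K : ℕ → Set Ω) : Set (SignedMeasure Ω) :=
  (fun p : FiniteMeasure Ω × FiniteMeasure Ω =>
    (p.1 : Measure Ω).toSignedMeasure - (p.2 : Measure Ω).toSignedMeasure) ''
    tightFiniteMeasures C u K ×ˢ tightFiniteMeasures C u K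

omit [TopologicalSpace Ω] [BorelSpace Ω] in
theorem add_mem_tightFiniteMeasures {C : ℝ≥0} {u : ℕ → ℝ≥0} {K : ℕ → Set Ω}
    {μ ν : FiniteMeasure Ω} (hμ : μ ∈ tightFiniteMeasures C u K)
    (hν : ν ∈ tightFiniteMeasures C u K) {a b : ℝ≥0} (hab : a + b ≤ 1) :
    a • μ + b • ν ∈ tightFiniteMeasures C u K := by
  have key : ∀ x y c : ℝ≥0, x ≤ c → y ≤ c → a * x + b * y ≤ c := fun x y c hx hy =>
    calc a * x + b * y ≤ a * c + b * c := by gcongr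
      _ = (a + b) * c := (add_mul _ _ _).symm
      _ ≤ 1 * c := by gcongr
      _ = c := one_mul c
  refine ⟨?_, fun n => ?_⟩
  · have := key _ _ _ hμ.1 hν.1
    simpa [FiniteMeasure.mass] using this
  · have := key _ _ _ (hμ.2 n) (hν.2 n)
    simpa using this

omit [TopologicalSpace Ω] [BorelSpace Ω] in
theorem toSignedMeasure_smul_add (μ ν : FiniteMeasure Ω) (a b : ℝ≥0) :
    ((a • μ + b • ν : FiniteMeasure Ω) : Measure Ω).toSignedMeasure =
      (a : ℝ) • (μ : Measure Ω).toSignedMeasure + (b : ℝ) • (ν : Measure Ω).toSignedMeasure := by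
  ext s hs
  simp only [add_apply, smul_apply, Measure.toSignedMeasure_apply_measurable hs,
    FiniteMeasure.toMeasure_add, FiniteMeasure.toMeasure_smul, Measure.real, Measure.add_apply,
    Measure.smul_apply, smul_eq_mul, ENNReal.smul_def]
  rw [ENNReal.toReal_add (ENNReal.mul_ne_top (by simp) (measure_ne_top _ _))
    (ENNReal.mul_ne_top (by simp) (measure_ne_top _ _))]
  simp

omit [TopologicalSpace Ω] [BorelSpace Ω] in
theorem absConvex_tightSignedMeasures (C : ℝ≥0) (u : ℕ → ℝ≥0) (K : ℕ → Set Ω) :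
    AbsConvex ℝ (tightSignedMeasures C u K) := by
  constructor
  · refine balanced_iff_smul_mem.2 ?_
    rintro a ha _ ⟨⟨μ, ν⟩, ⟨hμ, hν⟩, rfl⟩
    dsimp only at hμ hν ⊢
    have ha' : ‖a‖₊ + 0 ≤ 1 := by rw [add_zero]; exact_mod_cast ha
    have h1 := add_mem_tightFiniteMeasures hμ hμ ha'
    have h2 := add_mem_tightFiniteMeasures hν hν ha'
    rcases le_total 0 a with h0 | h0
    · refine ⟨(_, _), ⟨h1, h2⟩, ?_⟩
      simp only [toSignedMeasure_smul_add, coe_nnnorm, Real.norm_of_nonneg h0]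
      simp [smul_sub]
    -- A negative scalar exchanges the two measures of the difference.
    · refine ⟨(_, _), ⟨h2, h1⟩, ?_⟩
      simp only [toSignedMeasure_smul_add, coe_nnnorm, Real.norm_of_nonpos h0]
      ext s hs
      simp only [NNReal.coe_zero, zero_smul, add_zero, sub_apply, smul_apply, smul_eq_mul]
      ring
  · rintro _ ⟨⟨μ, ν⟩, ⟨hμ, hν⟩, rfl⟩ _ ⟨⟨μ', ν'⟩, ⟨hμ', hν'⟩, rfl⟩ a b ha hb hab
    lift a to ℝ≥0 using ha
    lift b to ℝ≥0 using hb
    have hab' : a + b ≤ 1 := by exact_mod_cast hab.le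
    refine ⟨(_, _), ⟨add_mem_tightFiniteMeasures hμ hμ' hab',
      add_mem_tightFiniteMeasures hν hν' hab'⟩, ?_⟩
    simp only [toSignedMeasure_smul_add, smul_sub]
    abel

/-- The tight finite measures are compact by Prokhorov's theorem, and the difference map is
continuous because its pairing with each `f` is. -/
theorem isCompact_tightSignedMeasures [PolishSpace Ω] (C : ℝ≥0) {u : ℕ → ℝ≥0} {K : ℕ → Set Ω}
    (hu : Tendsto u atTop (𝓝 0)) (hK : ∀ n, IsCompact (K n)) :
    IsCompact (X := WeakBilin (caPairing Ω).flip) (tightSignedMeasures C u K) := by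
  have hc : IsCompact (tightFiniteMeasures C u K) :=
    isCompact_setOfPred_finiteMeasure_mass_le_compl_isCompact_le C hu hK (Or.inl inferInstance)
  refine (hc.prod hc).image (Y := WeakBilin (caPairing Ω).flip)
    (WeakBilin.continuous_of_continuous_eval _ fun f => ?_)
  have : ∀ p : FiniteMeasure Ω × FiniteMeasure Ω, (caPairing Ω).flip
      ((p.1 : Measure Ω).toSignedMeasure - (p.2 : Measure Ω).toSignedMeasure) f =
      ∫ ω, f ω ∂(p.1 : Measure Ω) - ∫ ω, f ω ∂(p.2 : Measure Ω) :=
    fun p => caPairing_toSignedMeasure_sub f _ _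
  have hcont := FiniteMeasure.continuous_integral_boundedContinuousFunction f
  exact ((hcont.comp continuous_fst).sub (hcont.comp continuous_snd)).congr fun p => (this p).symm

end Compactness

/-! ### Subgradients and the conjugate of the robust integral -/

namespace RobustIntegrand

open scoped NNReal

variable {Ω : Type*} [TopologicalSpace Ω] [MeasurableSpace Ω] [BorelSpace Ω]
  {𝒬 : Set (ProbabilityMeasure Ω)} {φ : Ω → ℝ → ℝ} (h : RobustIntegrand 𝒬 φ)
include h

/-- The right derivative is a subgradient, and it is measurable as a limit of difference quotients.
-/
theorem exists_measurable_subgradient {f : Ω → ℝ} (hf : Measurable f) :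
    ∃ η : Ω → ℝ, Measurable η ∧ ∀ ω x, φ ω (f ω) + η ω * (x - f ω) ≤ φ ω x := by
  set η : Ω → ℝ := fun ω => derivWithin (φ ω) (Ioi (f ω)) (f ω)
  have hint : ∀ ω, f ω ∈ interior (univ : Set ℝ) := by simp
  refine ⟨η, ?_, fun ω x => ?_⟩
  · have htend : ∀ ω, Tendsto (fun n : ℕ => slope (φ ω) (f ω) (f ω + 1 / ((n : ℝ) + 1)))
        atTop (𝓝 (η ω)) := fun ω => by
      have h1 := (hasDerivWithinAt_iff_tendsto_slope' self_notMem_Ioi).1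
        ((h.convexOn ω).hasDerivWithinAt_rightDeriv_of_mem_interior (hint ω))
      refine h1.comp (tendsto_nhdsWithin_iff.2 ⟨?_, Eventually.of_forall fun n => ?_⟩)
      · simpa using (tendsto_const_nhds (x := f ω)).add
          (tendsto_one_div_add_atTop_nhds_zero_nat (𝕜 := ℝ))
      · rw [mem_Ioi, lt_add_iff_pos_right]
        positivity
    refine measurable_of_tendsto_metrizable (fun n => ?_) (tendsto_pi_nhds.2 htend)
    have h1 := h.measurable_comp hf
    have h2 := h.measurable_comp (hf.add_const (1 / ((n : ℝ) + 1)))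
    simp only [slope_def_field]
    exact (h2.sub h1).div ((hf.add_const _).sub hf)
  · rcases lt_trichotomy x (f ω) with hx | hx | hx
    · have h1 := ((h.convexOn ω).slope_le_leftDeriv_of_mem_interior (mem_univ x) (hint ω) hx).trans
        ((h.convexOn ω).leftDeriv_le_rightDeriv_of_mem_interior (hint ω))
      rw [slope_def_field, div_le_iff₀ (by linarith)] at h1
      linarith
    · simp [hx]
    · have h1 := (h.convexOn ω).rightDeriv_le_slope_of_mem_interior (hint ω) (mem_univ x) hx
      rw [slope_def_field, le_div_iff₀ (by linarith)] at h1
      linarith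

/-- For `ν = η P` with `η` a measurable subgradient along `f`, Young's inequality is an equality.
Comparing `φ` at `f` and `f ± 1` dominates `η` by twice the envelope on `[-‖f‖ - 1, ‖f‖ + 1]`, so
`ν` is finite. -/
theorem exists_divergence_le (f : Ω →ᵇ ℝ) {P : ProbabilityMeasure Ω} (hP : P ∈ 𝒬) :
    ∃ ν : SignedMeasure Ω, divergence φ ν P ≤
      ((caPairing Ω f ν - ∫ ω, φ ω (f ω) ∂(P : Measure Ω) : ℝ) : EReal) := by
  obtain ⟨η, hηm, hη⟩ := h.exists_measurable_subgradient f.continuous.measurable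
  have hbound : ∀ ω, |η ω| ≤ 2 * integrandEnvelope φ (‖f‖ + 1) ω := fun ω => by
    have hf : |f ω| ≤ ‖f‖ := f.norm_coe_le_norm ω
    have h1 := (abs_le.1 (h.abs_le_integrandEnvelope (M := ‖f‖ + 1) (x := f ω) (by linarith) ω)).1
    have h2 := (abs_le.1 (h.abs_le_integrandEnvelope (M := ‖f‖ + 1) (x := f ω + 1)
      ((abs_add_le _ _).trans (by simpa using hf)) ω)).2
    have h3 := (abs_le.1 (h.abs_le_integrandEnvelope (M := ‖f‖ + 1) (x := f ω - 1)
      ((abs_sub _ _).trans (by simpa using hf)) ω)).2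
    have h4 := hη ω (f ω + 1)
    have h5 := hη ω (f ω - 1)
    rw [abs_le]
    constructor <;> linarith
  have hint : Integrable η (P : Measure Ω) :=
    ((h.integrable_integrandEnvelope (‖f‖ + 1) hP).const_mul 2).mono' hηm.aestronglyMeasurable
      (Eventually.of_forall hbound)
  set ν : SignedMeasure Ω := (P : Measure Ω).withDensityᵥ η with hν
  have hac : ν ≪ᵥ (P : Measure Ω).toENNRealVectorMeasure :=
    Measure.withDensityᵥ_absolutelyContinuous _ _
  have hae : ν.rnDeriv (P : Measure Ω) =ᵐ[(P : Measure Ω)] η :=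
    (SignedMeasure.integrable_rnDeriv _ _).ae_eq_of_withDensityᵥ_eq hint
      (SignedMeasure.withDensityᵥ_rnDeriv_eq ν (P : Measure Ω) hac)
  have hi : Integrable (fun ω => f ω * η ω) (P : Measure Ω) :=
    hint.bdd_mul f.continuous.measurable.aestronglyMeasurable
      (Eventually.of_forall f.norm_coe_le_norm)
  have hi2 := h.integrable_comp_bcf f hP
  refine ⟨ν, ?_⟩
  rw [divergence, if_pos hac, hν, caPairing_withDensityᵥ f _ hint hηm, ← integral_sub hi hi2]
  refine le_trans (erealExpectation_mono P (hae.mono fun ω hω => ?_))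
    (erealExpectation_coe (hi.sub hi2)).le
  rw [← hν, hω]
  refine iSup_le fun x => EReal.coe_le_coe_iff.2 ?_
  have := hη ω x
  simp only [Pi.sub_apply]
  linarith

variable [PolishSpace Ω]

theorem iSup_caPairing_sub_robustIntegral (hne : 𝒬.Nonempty) (hc : IsCompact 𝒬)
    (hconv : Convex ℝ
      ((fun P : ProbabilityMeasure Ω => (P : Measure Ω).toSignedMeasure) '' 𝒬))
    (ν : SignedMeasure Ω) :
    ⨆ f : Ω →ᵇ ℝ, (((caPairing Ω f ν : ℝ) : EReal) - robustIntegral φ 𝒬 f) =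
      robustDivergence φ 𝒬 ν := by
  refine le_antisymm (iSup_le fun f => le_iInf₂ fun P hP => ?_) ?_
  · have hle := h.caPairing_sub_le_divergence f ν hP
    rw [EReal.coe_sub] at hle
    refine (EReal.sub_le_sub le_rfl ?_).trans hle
    rw [h.robustIntegral_eq]
    exact le_iSup₂ (f := fun (P : ProbabilityMeasure Ω) (_ : P ∈ 𝒬) =>
      ((∫ ω, φ ω (f ω) ∂(P : Measure Ω) : ℝ) : EReal)) P hP
  · refine le_of_forall_lt fun c' hc' => ?_
    obtain ⟨c, hc'c, hcJ⟩ := EReal.lt_iff_exists_real_btwn.1 hc'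
    obtain ⟨f, hf⟩ := hc.exists_forall_le_of_convexlike
      (fun P (f : Ω →ᵇ ℝ) => caPairing Ω f ν - ∫ ω, φ ω (f ω) ∂(P : Measure Ω))
      (fun f P hP c hc => by
        filter_upwards [h.upperSemicontinuousOn_integral f P hP (caPairing Ω f ν - c)
          (by linarith)] with P' hP'
        linarith)
      (fun P₁ h₁ P₂ h₂ a b ha hb hab => by
        obtain ⟨P, hP, hPeq⟩ := exists_mem_integral_eq_of_convex hconv h₁ h₂ ha hb hab
        refine ⟨P, hP, fun f => ?_⟩
        rw [hPeq _ (h.integrable_comp_bcf f h₁) (h.integrable_comp_bcf f h₂)]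
        have : caPairing Ω f ν = a * caPairing Ω f ν + b * caPairing Ω f ν := by
          rw [← add_mul, hab, one_mul]
        linarith)
      (fun P hP => ⟨convex_univ, fun f _ g _ a b ha hb hab => by
        have hi := ((h.integrable_comp_bcf f hP).const_mul a).add
          ((h.integrable_comp_bcf g hP).const_mul b)
        have := integral_mono (h.integrable_comp_bcf (a • f + b • g) hP) hi fun ω =>
          (h.convexOn ω).2 (mem_univ (f ω)) (mem_univ (g ω)) ha hb hab
        simp only [Pi.add_apply] at this
        rw [integral_add ((h.integrable_comp_bcf f hP).const_mul a)
          ((h.integrable_comp_bcf g hP).const_mul b), integral_const_mul, integral_const_mul] at this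
        simp only [map_add, map_smul, LinearMap.add_apply, LinearMap.smul_apply, smul_eq_mul]
        linarith⟩)
      (fun P hP => h.exists_bcf_lt_of_lt_divergence hP (hcJ.trans_le (iInf₂_le P hP)))
    refine hc'c.trans_le (le_trans ?_ (le_iSup _ f))
    -- The minimax bound holds for every `P`, in particular for the one attaining the robust
    -- integral at `f`.
    obtain ⟨P, hP, hPeq⟩ := h.exists_robustIntegral_eq hne hc f
    rw [hPeq, ← EReal.coe_sub]
    exact EReal.coe_le_coe_iff.2 (hf P hP)

/-- The robust divergence is a real number at a subgradient of the robust integral. -/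
theorem exists_robustDivergence_eq (hne : 𝒬.Nonempty) (hc : IsCompact 𝒬)
    (hconv : Convex ℝ
      ((fun P : ProbabilityMeasure Ω => (P : Measure Ω).toSignedMeasure) '' 𝒬))
    (f : Ω →ᵇ ℝ) : ∃ ν : SignedMeasure Ω, robustDivergence φ 𝒬 ν =
      ((caPairing Ω f ν - (robustIntegral φ 𝒬 f).toReal : ℝ) : EReal) := by
  obtain ⟨P, hP, hPeq⟩ := h.exists_robustIntegral_eq hne hc f
  obtain ⟨ν, hν⟩ := h.exists_divergence_le f hP
  refine ⟨ν, ?_⟩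
  rw [hPeq, EReal.toReal_coe]
  refine le_antisymm ((iInf₂_le P hP).trans hν) ?_
  rw [← h.iSup_caPairing_sub_robustIntegral hne hc hconv ν]
  refine le_trans ?_ (le_iSup _ f)
  rw [hPeq, EReal.coe_sub]

theorem coe_toReal_robustIntegral (hne : 𝒬.Nonempty) (hc : IsCompact 𝒬) (f : Ω →ᵇ ℝ) :
    ((robustIntegral φ 𝒬 f).toReal : EReal) = robustIntegral φ 𝒬 f := by
  obtain ⟨P, hP, hPeq⟩ := h.exists_robustIntegral_eq hne hc f
  rw [hPeq, EReal.toReal_coe]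

/-! ### Compactness of sublevel sets of the robust divergence -/

-- Young's inequality at `x = ±k`, with the sign of the density, gives `k |η| ≤ φ*(·, η) + max (φ(·,
-- -k)) (φ(·, k))`. The negative part of `φ*` is at most `φ(·, 0)⁺`, so a bound on the divergence
-- bounds the integral of the positive part, uniformly in `ν` and `P`.
omit [PolishSpace Ω] in
theorem exists_setLIntegral_rnDeriv_le (c : ℝ) : ∃ C : ℝ≥0∞, C ≠ ∞ ∧
    ∀ (ν : SignedMeasure Ω), ∀ P ∈ 𝒬, divergence φ ν P ≤ c → ∀ (A : Set Ω) (k : ℝ), 0 ≤ k →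
      ∫⁻ ω in A, ENNReal.ofReal (k * |ν.rnDeriv (P : Measure Ω) ω|) ∂(P : Measure Ω) ≤
        C + ∫⁻ ω in A, ENNReal.ofReal (integrandUpper φ k ω) ∂(P : Measure Ω) := by
  obtain ⟨C, hC, hle⟩ := h.exists_upper_le 0
  refine ⟨ENNReal.ofReal c + C, by simp [hC], fun ν P hP hdiv A k hk => ?_⟩
  have hac : ν ≪ᵥ (P : Measure Ω).toENNRealVectorMeasure := by
    by_contra hac
    rw [divergence, if_neg hac] at hdiv
    exact absurd hdiv (by simp)
  rw [divergence, if_pos hac] at hdiv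
  set η := ν.rnDeriv (P : Measure Ω)
  have hneg : ∫⁻ ω, (-integrandConj φ ω (η ω)).toENNReal ∂(P : Measure Ω) ≤ C := by
    refine (lintegral_mono fun ω => ?_).trans (hle P hP)
    have h1 : -integrandConj φ ω (η ω) ≤ ((integrandUpper φ 0 ω : ℝ) : EReal) := by
      rw [EReal.neg_le, ← EReal.coe_neg]
      refine le_trans (EReal.coe_le_coe_iff.2 ?_) (le_integrandConj φ ω 0 (η ω))
      have := h.le_integrandUpper (M := 0) (x := 0) (by simp) ω
      linarith
    refine (EReal.toENNReal_le_toENNReal h1).trans ?_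
    simp [EReal.toENNReal_of_ne_top]
  have hpos : ∫⁻ ω, (integrandConj φ ω (η ω)).toENNReal ∂(P : Measure Ω) ≤
      ENNReal.ofReal c + C := by
    rw [erealExpectation, EReal.sub_le_iff_le_add] at hdiv
    · rw [← EReal.coe_ennreal_le_coe_ennreal_iff]
      refine hdiv.trans ?_
      rw [EReal.coe_ennreal_add]
      gcongr
      · rw [EReal.coe_ennreal_ofReal]
        exact EReal.coe_le_coe_iff.2 (le_max_left _ _)
      · exact EReal.coe_ennreal_le_coe_ennreal_iff.2 hneg
    · exact Or.inl (EReal.coe_ennreal_ne_bot _)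
    · exact Or.inl (by simpa using ne_top_of_le_ne_top hC hneg)
  have hpt : ∀ ω, ENNReal.ofReal (k * |η ω|) ≤
      (integrandConj φ ω (η ω)).toENNReal + ENNReal.ofReal (integrandUpper φ k ω) := fun ω => by
    obtain ⟨x, hxk, hx⟩ : ∃ x : ℝ, |x| ≤ k ∧ x * η ω = k * |η ω| := by
      rcases abs_choice (η ω) with h' | h'
      · exact ⟨k, (abs_of_nonneg hk).le, by rw [h']⟩
      · exact ⟨-k, by rw [abs_neg, abs_of_nonneg hk], by rw [h']; ring⟩
    have h1 := EReal.toENNReal_le_toENNReal (le_integrandConj φ ω x (η ω))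
    rw [EReal.toENNReal_of_ne_top (EReal.coe_ne_top _), EReal.toReal_coe] at h1
    refine le_trans ?_ (add_le_add_left h1 _)
    refine le_trans (ENNReal.ofReal_le_ofReal ?_) ENNReal.ofReal_add_le
    linarith [h.le_integrandUpper hxk ω]
  calc ∫⁻ ω in A, ENNReal.ofReal (k * |η ω|) ∂(P : Measure Ω)
      ≤ ∫⁻ ω in A, ((integrandConj φ ω (η ω)).toENNReal +
          ENNReal.ofReal (integrandUpper φ k ω)) ∂(P : Measure Ω) := lintegral_mono hpt
    _ = ∫⁻ ω in A, (integrandConj φ ω (η ω)).toENNReal ∂(P : Measure Ω) +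
          ∫⁻ ω in A, ENNReal.ofReal (integrandUpper φ k ω) ∂(P : Measure Ω) :=
        lintegral_add_right _ (h.measurable_integrandUpper k).ennreal_ofReal
    _ ≤ _ := by
        gcongr
        exact (setLIntegral_le_lintegral _ _).trans hpos

/-- Sublevel sets of the robust divergence are contained in absolutely convex compact sets. -/
theorem exists_absConvex_isCompact_superset (hc : IsCompact 𝒬) (c : ℝ) :
    ∃ K : Set (SignedMeasure Ω), AbsConvex ℝ K ∧
      IsCompact (X := WeakBilin (caPairing Ω).flip) K ∧
      ∀ ν, robustDivergence φ 𝒬 ν ≤ c → ν ∈ K := by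
  -- The slack `1` provides some `P` with divergence below `c + 1`, without attainment of the
  -- infimum.
  obtain ⟨C, hC, hdens⟩ := h.exists_setLIntegral_rnDeriv_le (c + 1)
  have htight : ∀ ε : ℝ≥0∞, 0 < ε → ∃ K : Set Ω, IsCompact K ∧
      ∀ P ∈ 𝒬, (P : Measure Ω) Kᶜ ≤ ε := by
    let := TopologicalSpace.upgradeIsCompletelyMetrizable Ω
    have := isTightMeasureSet_of_isCompact_closure (S := 𝒬) (by rwa [hc.isClosed.closure_eq])
    rw [isTightMeasureSet_iff_exists_isCompact_measure_compl_le] at this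
    intro ε hε
    obtain ⟨K, hK, hle⟩ := this ε hε
    exact ⟨K, hK, fun P hP => hle _ ⟨P, hP, rfl⟩⟩
  have htail : ∀ n : ℕ, ∃ K : Set Ω, IsCompact K ∧ ∀ (ν : SignedMeasure Ω), ∀ P ∈ 𝒬,
      divergence φ ν P ≤ ((c + 1 : ℝ) : EReal) →
      ∫⁻ ω in Kᶜ, ENNReal.ofReal |ν.rnDeriv (P : Measure Ω) ω| ∂(P : Measure Ω) ≤
        ((((n : ℝ≥0) + 1)⁻¹ : ℝ≥0) : ℝ≥0∞) := by
    intro n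
    -- The tail estimate is `k X ≤ C + 1 + 1`: `C` from the divergence, `1` from the excess over
    -- `N`, and `1` from `N P(Kᶜ)`. This `k` yields `X ≤ 1 / (n + 1)`.
    set k : ℝ := ((n : ℝ) + 1) * (C.toReal + 2) with hk
    have hk0 : 0 ≤ k := by positivity
    obtain ⟨N, hN, hexc⟩ := h.exists_excess_upper_le k one_ne_zero
    obtain ⟨K, hK, hKle⟩ := htight (ENNReal.ofReal N)⁻¹ (by simp)
    refine ⟨K, hK, fun ν P hP hdiv => ?_⟩
    have h1 := hdens ν P hP hdiv Kᶜ k hk0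
    have h2 : ∫⁻ ω in Kᶜ, ENNReal.ofReal (integrandUpper φ k ω) ∂(P : Measure Ω) ≤ 1 + 1 :=
      calc ∫⁻ ω in Kᶜ, ENNReal.ofReal (integrandUpper φ k ω) ∂(P : Measure Ω)
          ≤ ∫⁻ ω in Kᶜ, (ENNReal.ofReal (integrandUpper φ k ω - N) + ENNReal.ofReal N)
              ∂(P : Measure Ω) := lintegral_mono fun ω => by
            refine le_trans (le_of_eq ?_) ENNReal.ofReal_add_le
            rw [sub_add_cancel]
        _ = ∫⁻ ω in Kᶜ, ENNReal.ofReal (integrandUpper φ k ω - N) ∂(P : Measure Ω) +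
              ENNReal.ofReal N * (P : Measure Ω) Kᶜ := by
            rw [lintegral_add_right _ measurable_const, setLIntegral_const]
        _ ≤ 1 + 1 := by
            gcongr
            · exact (setLIntegral_le_lintegral _ _).trans (hexc P hP)
            · exact (mul_le_mul_right (hKle P hP) _).trans (ENNReal.mul_inv_le_one _)
    have h3 : ENNReal.ofReal k = ((n : ℝ≥0∞) + 1) * (C + 2) := by
      rw [hk, ENNReal.ofReal_mul (by positivity), ENNReal.ofReal_add (by positivity) (by norm_num),
        ENNReal.ofReal_add (by positivity) (by norm_num), ENNReal.ofReal_toReal hC]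
      simp
    simp_rw [ENNReal.ofReal_mul hk0] at h1
    rw [lintegral_const_mul' _ _ ENNReal.ofReal_ne_top, h3] at h1
    set X := ∫⁻ ω in Kᶜ, ENNReal.ofReal |ν.rnDeriv (P : Measure Ω) ω| ∂(P : Measure Ω)
    have h4 : ((n : ℝ≥0∞) + 1) * X * (C + 2) ≤ 1 * (C + 2) := by
      calc ((n : ℝ≥0∞) + 1) * X * (C + 2) = ((n : ℝ≥0∞) + 1) * (C + 2) * X := by ring
        _ ≤ C + (1 + 1) := h1.trans (by gcongr)
        _ = 1 * (C + 2) := by rw [one_mul, one_add_one_eq_two]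
    rw [ENNReal.mul_le_mul_iff_left (by simp) (by simp [hC])] at h4
    rw [ENNReal.coe_inv (by positivity), ENNReal.le_inv_iff_mul_le, mul_comm]
    simpa using h4
  choose K hK hKtail using htail
  obtain ⟨C₁, hC₁, hupper⟩ := h.exists_upper_le 1
  refine ⟨tightSignedMeasures (C + C₁).toNNReal (fun n => ((n : ℝ≥0) + 1)⁻¹) K,
    absConvex_tightSignedMeasures _ _ _, isCompact_tightSignedMeasures _ ?_ hK, fun ν hν => ?_⟩
  · refine NNReal.tendsto_coe.1 ?_
    simpa using tendsto_one_div_add_atTop_nhds_zero_nat (𝕜 := ℝ)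
  · have hlt : robustDivergence φ 𝒬 ν < ((c + 1 : ℝ) : EReal) :=
      hν.trans_lt (EReal.coe_lt_coe_iff.2 (by linarith))
    simp only [robustDivergence, iInf_lt_iff] at hlt
    obtain ⟨P, hP, hlt⟩ := hlt
    have hac : ν ≪ᵥ (P : Measure Ω).toENNRealVectorMeasure := by
      by_contra hac
      rw [divergence, if_neg hac] at hlt
      exact not_top_lt hlt
    have hη := SignedMeasure.integrable_rnDeriv ν (P : Measure Ω)
    have hνeq := SignedMeasure.withDensityᵥ_rnDeriv_eq ν (P : Measure Ω) hac
    have hmass := hdens ν P hP hlt.le univ 1 zero_le_one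
    have htail := fun n => hKtail n ν P hP hlt.le
    set η := ν.rnDeriv (P : Measure Ω)
    have h1 := isFiniteMeasure_withDensity_ofReal hη.2
    have h2 := isFiniteMeasure_withDensity_ofReal hη.neg.2
    rw [withDensityᵥ_eq_withDensity_pos_part_sub_withDensity_neg_part hη] at hνeq
    simp only [one_mul, Measure.restrict_univ] at hmass
    have hmem : ∀ (μ : FiniteMeasure Ω) (ζ : Ω → ℝ), (∀ ω, ζ ω ≤ |η ω|) →
        (μ : Measure Ω) = (P : Measure Ω).withDensity (fun ω => ENNReal.ofReal (ζ ω)) →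
        μ ∈ tightFiniteMeasures (C + C₁).toNNReal (fun n => ((n : ℝ≥0) + 1)⁻¹) K := by
      intro μ ζ hζ hμ
      refine ⟨?_, fun n => ?_⟩
      · rw [← ENNReal.coe_le_coe, FiniteMeasure.ennreal_mass,
          ENNReal.coe_toNNReal (ENNReal.add_ne_top.2 ⟨hC, hC₁⟩), hμ,
          withDensity_apply _ MeasurableSet.univ, Measure.restrict_univ]
        refine (lintegral_mono fun ω => ENNReal.ofReal_le_ofReal (hζ ω)).trans (hmass.trans ?_)
        gcongr
        exact hupper P hP
      · rw [← ENNReal.coe_le_coe, FiniteMeasure.ennreal_coeFn_eq_coeFn_toMeasure, hμ,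
          withDensity_apply _ (hK n).isClosed.measurableSet.compl]
        exact (lintegral_mono fun ω => ENNReal.ofReal_le_ofReal (hζ ω)).trans (htail n)
    exact ⟨(⟨_, h1⟩, ⟨_, h2⟩), ⟨hmem _ η (fun ω => le_abs_self _) rfl,
      hmem _ (fun ω => -η ω) (fun ω => neg_le_abs _) rfl⟩, hνeq⟩

/-! ### Mackey continuity and the dual representation -/

theorem continuous_toReal_robustIntegral (hne : 𝒬.Nonempty) (hc : IsCompact 𝒬)
    (hconv : Convex ℝ
      ((fun P : ProbabilityMeasure Ω => (P : Measure Ω).toSignedMeasure) '' 𝒬)) :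
    Continuous[mackeyTopology (caPairing Ω), UniformSpace.toTopologicalSpace]
      fun f : Ω →ᵇ ℝ => (robustIntegral φ 𝒬 f).toReal := by
  refine continuous_mackeyTopology_of_forall _ fun e ε hε => ?_
  -- Translating the integrand by `e` reduces continuity at `e` to control near `0`.
  have h' := h.translate e
  set φ' : Ω → ℝ → ℝ := fun ω x => φ ω (e ω + x)
  have hφ' : ∀ g : Ω →ᵇ ℝ, robustIntegral φ 𝒬 (e + g) = robustIntegral φ' 𝒬 g := fun _ => rfl
  set I : (Ω →ᵇ ℝ) → ℝ := fun g => (robustIntegral φ' 𝒬 g).toReal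
  have hI : ∀ g, robustIntegral φ' 𝒬 g = (I g : EReal) := fun g =>
    (h'.coe_toReal_robustIntegral hne hc g).symm
  have hJ : ∀ ν, ⨆ f : Ω →ᵇ ℝ, ((caPairing Ω f ν - I f : ℝ) : EReal) =
      robustDivergence φ' 𝒬 ν := fun ν => by
    simp_rw [← h'.iSup_caPairing_sub_robustIntegral hne hc hconv ν, hI, EReal.coe_sub]
  -- The level `1 - I 0` is the one required by `abs_sub_le_of_subgradient`, since the conjugate of
  -- `I` has minimum `-I 0`.
  obtain ⟨K, hK1, hK2, hK⟩ := h'.exists_absConvex_isCompact_superset hc (1 - I 0)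
  have hε' : 0 < min ε 1 := lt_min hε one_pos
  refine ⟨K, hK1, hK2, min ε 1 / 2, by positivity, fun g hg => ?_⟩
  have := abs_sub_le_of_subgradient (caPairing Ω) (I := I) (K := K) (fun f => ?_) (fun ν hν => ?_)
    hε' (min_le_right _ _) hg
  · rw [← add_zero e, add_assoc, zero_add, hφ', hφ']
    exact this.trans (by linarith [min_le_left ε 1])
  · obtain ⟨ν, hν⟩ := h'.exists_robustDivergence_eq hne hc hconv f
    refine ⟨ν, fun f' => EReal.coe_le_coe_iff.1 ?_⟩
    rw [← hJ] at hν
    exact (le_iSup (fun f : Ω →ᵇ ℝ => ((caPairing Ω f ν - I f : ℝ) : EReal)) f').trans hν.le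
  · refine hK ν ?_
    rw [← hJ]
    exact iSup_le fun f => EReal.coe_le_coe_iff.2 (hν f)

theorem isGreatest_robustIntegral (hne : 𝒬.Nonempty) (hc : IsCompact 𝒬)
    (hconv : Convex ℝ
      ((fun P : ProbabilityMeasure Ω => (P : Measure Ω).toSignedMeasure) '' 𝒬))
    (f : Ω →ᵇ ℝ) :
    IsGreatest
      (range fun ν : SignedMeasure Ω =>
        ((caPairing Ω f ν : ℝ) : EReal) - robustDivergence φ 𝒬 ν)
      (robustIntegral φ 𝒬 f) := by
  have hI := h.coe_toReal_robustIntegral hne hc f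
  constructor
  · obtain ⟨ν, hν⟩ := h.exists_robustDivergence_eq hne hc hconv f
    refine ⟨ν, ?_⟩
    dsimp only
    rw [hν, ← EReal.coe_sub, sub_sub_cancel, hI]
  · rintro _ ⟨ν, rfl⟩
    have hle : ((caPairing Ω f ν - (robustIntegral φ 𝒬 f).toReal : ℝ) : EReal) ≤
        robustDivergence φ 𝒬 ν := by
      rw [← h.iSup_caPairing_sub_robustIntegral hne hc hconv ν, EReal.coe_sub, hI]
      exact le_iSup (fun f : Ω →ᵇ ℝ =>
        ((caPairing Ω f ν : ℝ) : EReal) - robustIntegral φ 𝒬 f) f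
    refine (EReal.sub_le_sub le_rfl hle).trans ?_
    rw [← EReal.coe_sub, sub_sub_cancel, hI]

end RobustIntegrand

theorem mainTheorem1 {Ω : Type*} [TopologicalSpace Ω] [PolishSpace Ω] [MeasurableSpace Ω]
    [BorelSpace Ω] (𝒬 : Set (ProbabilityMeasure Ω)) (h𝒬_nonempty : 𝒬.Nonempty)
    (h𝒬_convex : Convex ℝ ((fun P : ProbabilityMeasure Ω => (P : Measure Ω).toSignedMeasure) '' 𝒬))
    (h𝒬_compact : IsCompact 𝒬)
    (φ : Ω → ℝ → ℝ)
    (hφ_convex : ∀ ω, ConvexOn ℝ univ (φ ω))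
    (hφ_usc : ∀ x, UpperSemicontinuous (fun ω => φ ω x))
    (hφ_pos : ∀ x, MemRobustL1b 𝒬 (fun ω => max (φ ω x) 0))
    (hφ_neg : MemRobustL1 𝒬 (fun ω => max (-φ ω 0) 0)) :
    -- the expectations defining the functional exist, and the functional is finite
    (∀ f : Ω →ᵇ ℝ, (∀ P ∈ 𝒬, Integrable (fun ω => φ ω (f ω)) (P : Measure Ω)) ∧
      robustIntegral φ 𝒬 f ≠ ⊥ ∧ robustIntegral φ 𝒬 f ≠ ⊤) ∧
    -- Mackey continuity
    Continuous[mackeyTopology (caPairing Ω), UniformSpace.toTopologicalSpace]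
      (fun f : Ω →ᵇ ℝ => (robustIntegral φ 𝒬 f).toReal) ∧
    -- the conjugate on the signed measures is the robust divergence
    (∀ ν : SignedMeasure Ω,
      (⨆ f : Ω →ᵇ ℝ, (((caPairing Ω f ν : ℝ) : EReal) - robustIntegral φ 𝒬 f)) =
        robustDivergence φ 𝒬 ν) ∧
    -- dual representation, with the maximum attained
    (∀ f : Ω →ᵇ ℝ,
      IsGreatest
        (range fun ν : SignedMeasure Ω =>
          ((caPairing Ω f ν : ℝ) : EReal) - robustDivergence φ 𝒬 ν)
        (robustIntegral φ 𝒬 f)) := by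
  have h := RobustIntegrand.of_memRobustL1b hφ_convex hφ_usc hφ_pos hφ_neg
  refine ⟨fun f => ⟨fun P hP => h.integrable_comp_bcf f hP, ?_⟩,
    h.continuous_toReal_robustIntegral h𝒬_nonempty h𝒬_compact h𝒬_convex,
    h.iSup_caPairing_sub_robustIntegral h𝒬_nonempty h𝒬_compact h𝒬_convex,
    h.isGreatest_robustIntegral h𝒬_nonempty h𝒬_compact h𝒬_convex⟩
  rw [← h.coe_toReal_robustIntegral h𝒬_nonempty h𝒬_compact f]
  exact ⟨EReal.coe_ne_bot _, EReal.coe_ne_top _⟩
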